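/- Work over $\mathbb{C}$. Let $D_6\subset\mathbb{P}^6$ be the sextic del Pezzo surface that is the Zariski closure of the image of the rational map $\mathbb{P}^2\dashrightarrow\mathbb{P}^6$, $$[x_0:x_1:x_2]\mapsto[x_0x_1^2:x_0x_2^2:x_1^2x_2:x_0^2x_1:x_2^2x_1:x_0^2x_2:x_0x_1x_2],$$ and let $\tilde D_6\subset\mathbb{P}^5$, with coordinates $[v_0:\dots:v_5]$, be its projection from the point $[0:0:0:0:0:0:1]$. Put $$F_1=v_2v_3^2-v_0^2v_5,\quad F_2=v_1v_3^2-v_0v_5^2,\quad F_3=v_2^2v_3-v_0^2v_4,$$ $$F_5=v_1^2v_3-v_4v_5^2,\quad F_6=v_1v_2^2-v_0v_4^2,\quad F_7=v_1^2v_2-v_4^2v_5,$$ $$A'_1=F_1+F_2-F_6-F_7,\qquad A'_2=F_2-F_3+F_5-F_6,$$ and let $Y'\subset\mathbb{P}^5$ be the subscheme defined by $A'_1=A'_2=0$. Then: (i) $Y'$ is a complete intersection (that is, $A'_1,A'_2$ is a regular sequence in $\mathbb{C}[v_0,\dots,v_5]$), and $\tilde D_6\subset Y'$. (ii) $Y'$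 has exactly $72$ singular points, and each of them is an ordinary double point, i.e. the completed local ring of $Y'$ there is isomorphic to $\mathbb{C}[[x_0,x_1,x_2,x_3]]/(x_0^2+x_1^2+x_2^2+x_3^2)$ as a $\mathbb{C}$-algebra. (iii) For each of these $72$ points $p$ there is a smooth irreducible projective surface $S\subset Y'$ with $p\in S$ (in particular, $S$ is smooth at $p$). (iv) The automorphism group of the projective variety $Y'$ contains a cyclic subgroup of order $6$. -/

import Mathlib

open MvPolynomial
open scoped LinearAlgebra.Projectivization

noncomputable section

/-- Complex projective space `ℙⁿ`, as a set of (closed) points. -/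
abbrev ProjSpace (n : ℕ) : Type := ℙ ℂ (Fin (n + 1) → ℂ)

/-- The polynomial ring `ℂ[v₀, …, vₙ]`. -/
abbrev CoordRing (n : ℕ) : Type := MvPolynomial (Fin (n + 1)) ℂ

namespace ProjVar

variable {n : ℕ}

/-- The points of `ℙⁿ` at which all elements of the (homogeneous) ideal `I` vanish: a point is a
line in `ℂⁿ⁺¹`, and the elements of `I` are required to vanish on that line. -/
def zeroSet (I : Ideal (CoordRing n)) : Set (ProjSpace n) :=
  {p | ∀ F ∈ I, ∀ v ∈ p.submodule, eval v F = 0}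

/-- The affine cone over a set of points of `ℙⁿ`. -/
def cone (S : Set (ProjSpace n)) : Set (Fin (n + 1) → ℂ) :=
  {v | ∃ p ∈ S, v ∈ p.submodule}

/-- The homogeneous ideal of all polynomials that vanish on `S`. -/
def idealOf (S : Set (ProjSpace n)) : Ideal (CoordRing n) :=
  MvPolynomial.vanishingIdeal ℂ (cone S)

/-- The Zariski closure of a subset of `ℙⁿ`. -/
def zariskiClosure (S : Set (ProjSpace n)) : Set (ProjSpace n) := zeroSet (idealOf S)

/-- The rank at `p` of the Jacobian matrix of the homogeneous ideal `I`: the dimension of the span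
of the gradients at `p` of the elements of `I`. -/
def jacobianRank (I : Ideal (CoordRing n)) (p : ProjSpace n) : ℕ :=
  Module.finrank ℂ (Submodule.span ℂ
    {g : Fin (n + 1) → ℂ | ∃ F ∈ I, g = fun j => eval p.rep (pderiv j F)})

/-- A point `p` of the subscheme of `ℙⁿ` of pure codimension `c` that is defined by the homogeneous
ideal `I` is smooth if the Jacobian matrix has rank `c` there. -/
def IsSmoothPoint (I : Ideal (CoordRing n)) (c : ℕ) (p : ProjSpace n) : Prop :=
  jacobianRank I p = c

/-- The singular points of the subscheme of pure codimension `c` defined by `I`. -/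
def singularLocus (I : Ideal (CoordRing n)) (c : ℕ) : Set (ProjSpace n) :=
  {p ∈ zeroSet I | ¬ IsSmoothPoint I c p}

/-- The coordinate ring of the part of the subscheme defined by `I` that lies in the affine chart
`vᵢ ≠ 0`, the chart being identified with the affine space `vᵢ = 1`. -/
abbrev ChartRing (I : Ideal (CoordRing n)) (i : Fin (n + 1)) : Type :=
  CoordRing n ⧸ (I ⊔ Ideal.span {X i - 1})

/-- The ideal in `ChartRing I i` of the point `w` of the chart. -/
def pointIdeal (I : Ideal (CoordRing n)) (i : Fin (n + 1)) (w : Fin (n + 1) → ℂ) :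
    Ideal (ChartRing I i) :=
  Ideal.map (Ideal.Quotient.mk _) (MvPolynomial.vanishingIdeal ℂ {w})

/-- The complete local ring of the subscheme defined by `I` at the point `w` of the chart `vᵢ = 1`:
the completion of the coordinate ring of the chart at the maximal ideal of `w` (which is also the
completion of the local ring at `w`). -/
abbrev CompleteLocalRing (I : Ideal (CoordRing n)) (i : Fin (n + 1)) (w : Fin (n + 1) → ℂ) : Type :=
  AdicCompletion (pointIdeal I i w) (ChartRing I i)

/-- The complete local ring `ℂ⟦x₀, …, x_d⟧ / (x₀² + ⋯ + x_d²)` of the `d`-dimensional node. -/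
abbrev NodeRing (d : ℕ) : Type :=
  MvPowerSeries (Fin (d + 1)) ℂ ⧸
    Ideal.span {∑ k, (MvPowerSeries.X k : MvPowerSeries (Fin (d + 1)) ℂ) ^ 2}

/-- `p` is an ordinary double point of the subscheme of `ℙⁿ` of pure codimension `c` (and dimension
`n - c`) that is defined by `I`: a singular point whose complete local ring is isomorphic to
`ℂ⟦x₀, …, x_d⟧ / (x₀² + ⋯ + x_d²)`, where `d = n - c`. -/
def IsOrdinaryDoublePoint (I : Ideal (CoordRing n)) (c : ℕ) (p : ProjSpace n) : Prop :=
  p ∈ singularLocus I c ∧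
    ∃ (i : Fin (n + 1)) (w : Fin (n + 1) → ℂ) (hw : w ≠ 0),
      Projectivization.mk ℂ w hw = p ∧ w i = 1 ∧
        Nonempty (CompleteLocalRing I i w ≃ₐ[ℂ] NodeRing (n - c))

/-- `S` is a smooth projective surface in `ℙⁿ`: a Zariski closed, irreducible subset of dimension
`2` (so that its homogeneous coordinate ring has dimension `3`) that is smooth at all its points. -/
structure IsSmoothSurface (S : Set (ProjSpace n)) : Prop where
  closed : zariskiClosure S = S
  irreducible : (idealOf S).IsPrime
  dim_eq_two : ringKrullDim (CoordRing n ⧸ idealOf S) = 3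
  smooth : ∀ p ∈ S, IsSmoothPoint (idealOf S) (n - 2) p

/-- The value at `v` of a tuple of polynomials. -/
def evalTuple (G : Fin (n + 1) → CoordRing n) (v : Fin (n + 1) → ℂ) : Fin (n + 1) → ℂ :=
  fun j => eval v (G j)

/-- A map from `Y ⊆ ℙⁿ` to itself is regular if around every point it is given by homogeneous
polynomials of the same degree without common zero there. (The tuple represents the map wherever it
does not vanish; a tuple that does so only on the neighbourhood `H ≠ 0` can be multiplied by `H`.) -/
def IsRegularMap (Y : Set (ProjSpace n)) (f : Y → Y) : Prop :=
  ∀ p : Y, ∃ (d : ℕ) (G : Fin (n + 1) → CoordRing n),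
    (∀ j, (G j).IsHomogeneous d) ∧ evalTuple G p.1.rep ≠ 0 ∧
      ∀ (q : Y) (h : evalTuple G q.1.rep ≠ 0),
        (f q : ProjSpace n) = Projectivization.mk ℂ (evalTuple G q.1.rep) h

theorem isRegularMap_id (Y : Set (ProjSpace n)) : IsRegularMap Y id := by
  intro p
  have key : ∀ v : Fin (n + 1) → ℂ, evalTuple (fun j => (X j : CoordRing n)) v = v := by
    intro v; funext j; simp [evalTuple]
  refine ⟨1, fun j => X j, fun j => isHomogeneous_X _ _, ?_, ?_⟩
  · rw [key]; exact p.1.rep_nonzero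
  · intro q h
    simp only [key, id]
    exact (Projectivization.mk_rep _).symm

theorem evalTuple_smul {d : ℕ} {G : Fin (n + 1) → CoordRing n}
    (hG : ∀ j, (G j).IsHomogeneous d) (a : ℂ) (v : Fin (n + 1) → ℂ) :
    evalTuple G (a • v) = a ^ d • evalTuple G v := by
  funext j
  simp only [evalTuple, Pi.smul_apply, smul_eq_mul, eval_eq, Finset.mul_sum]
  refine Finset.sum_congr rfl fun m hm => ?_
  have hd : ∑ i ∈ m.support, m i = d := by
    rw [← (hG j).degree_eq_sum_deg_support hm]
  simp only [mul_pow, Finset.prod_mul_distrib, Finset.prod_pow_eq_pow_sum, hd]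
  ring

theorem IsRegularMap.comp {Y : Set (ProjSpace n)} {f g : Y → Y}
    (hg : IsRegularMap Y g) (hf : IsRegularMap Y f) : IsRegularMap Y (g ∘ f) := by
  intro p
  obtain ⟨d, G, hG, hGp, hGf⟩ := hf p
  obtain ⟨d', G', hG', hG'p, hG'g⟩ := hg (f p)
  obtain ⟨j₀, hj₀⟩ := Function.ne_iff.mp hGp
  have key : ∀ v, evalTuple (fun j => G j₀ * bind₁ G (G' j)) v =
      eval v (G j₀) • evalTuple G' (evalTuple G v) := by
    intro v
    funext j
    have : eval v (bind₁ G (G' j)) = eval (evalTuple G v) (G' j) := by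
      change (eval₂Hom (RingHom.id ℂ) v) (bind₁ G (G' j)) = _
      rw [eval₂Hom_bind₁]
      rfl
    simp [evalTuple, this]
  -- the representative of `f q` is a nonzero multiple of the value of `G`
  have rep : ∀ (q : Y) (h : evalTuple G q.1.rep ≠ 0),
      ∃ a : ℂ, a ≠ 0 ∧ evalTuple G q.1.rep = a • (f q).1.rep := by
    intro q h
    have h1 := hGf q h
    rw [← Projectivization.mk_rep (f q).1, Projectivization.mk_eq_mk_iff] at h1
    obtain ⟨a, ha⟩ := h1
    refine ⟨(a⁻¹ : ℂˣ), Units.ne_zero _, ?_⟩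
    rw [← ha]
    simp [Units.smul_def]
  refine ⟨d + d * d', fun j => G j₀ * bind₁ G (G' j), ?_, ?_, ?_⟩
  · intro j
    refine (hG j₀).mul ?_
    exact (hG' j).aeval G hG
  · obtain ⟨a, ha, hrep⟩ := rep p hGp
    rw [key, hrep, evalTuple_smul hG']
    exact smul_ne_zero hj₀ (smul_ne_zero (pow_ne_zero _ ha) hG'p)
  · intro q h
    have h' := h
    rw [key] at h'
    have hq0 : eval q.1.rep (G j₀) ≠ 0 := fun h0 => h' (by rw [h0, zero_smul])
    have hq : evalTuple G q.1.rep ≠ 0 := fun h0 => hq0 (congrFun h0 j₀)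
    obtain ⟨a, ha, hrep⟩ := rep q hq
    rw [hrep, evalTuple_smul hG'] at h'
    have hq' : evalTuple G' (f q).1.rep ≠ 0 := fun h0 => h' (by rw [h0, smul_zero, smul_zero])
    change (g (f q) : ProjSpace n) = _
    rw [hG'g (f q) hq', Projectivization.mk_eq_mk_iff']
    refine ⟨(eval q.1.rep (G j₀) * a ^ d')⁻¹, ?_⟩
    rw [key, hrep, evalTuple_smul hG', smul_smul, smul_smul, mul_assoc,
      inv_mul_cancel₀ (mul_ne_zero hq0 (pow_ne_zero _ ha)), one_smul]

/-- The automorphism group of the projective variety `Y ⊆ ℙⁿ`: the regular bijections from `Y` to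
itself whose inverse is regular. -/
def autGroup (Y : Set (ProjSpace n)) : Subgroup (Equiv.Perm Y) where
  carrier := {e | IsRegularMap Y e ∧ IsRegularMap Y e.symm}
  mul_mem' := fun {_ _} ha hb => ⟨ha.1.comp hb.1, hb.2.comp ha.2⟩
  one_mem' := ⟨isRegularMap_id Y, isRegularMap_id Y⟩
  inv_mem' := fun {_} ha => ⟨ha.2, ha.1⟩

end ProjVar

open ProjVar

/-- The seven cubic forms in three variables that vanish at the three coordinate points of `ℙ²`. -/
def cubicForms (x : Fin 3 → ℂ) : Fin 7 → ℂ :=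
  ![x 0 * x 1 ^ 2, x 0 * x 2 ^ 2, x 1 ^ 2 * x 2, x 0 ^ 2 * x 1, x 2 ^ 2 * x 1, x 0 ^ 2 * x 2,
    x 0 * x 1 * x 2]

/-- The sextic del Pezzo surface `D₆ ⊆ ℙ⁶`, the closure of the image of the rational map
`ℙ² ⇢ ℙ⁶` given by the seven cubic forms. -/
def delPezzoD6 : Set (ProjSpace 6) :=
  zariskiClosure {p | ∃ (x : Fin 3 → ℂ) (hx : cubicForms x ≠ 0),
    p = Projectivization.mk ℂ (cubicForms x) hx}

/-- The surface `D̃₆ ⊆ ℙ⁵`, the projection of `D₆` from the point `[0:0:0:0:0:0:1]`. -/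
def delPezzoD6Tilde : Set (ProjSpace 5) :=
  {p | ∃ (u : Fin 7 → ℂ) (hu : u ≠ 0) (hu' : (fun j : Fin 6 => u j.castSucc) ≠ 0),
    (Projectivization.mk ℂ u hu : ProjSpace 6) ∈ delPezzoD6 ∧
      p = Projectivization.mk ℂ (fun j : Fin 6 => u j.castSucc) hu'}

/-- The cubic `F₁`. -/
def F1 : CoordRing 5 := X 2 * X 3 ^ 2 - X 0 ^ 2 * X 5
/-- The cubic `F₂`. -/
def F2 : CoordRing 5 := X 1 * X 3 ^ 2 - X 0 * X 5 ^ 2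
/-- The cubic `F₃`. -/
def F3 : CoordRing 5 := X 2 ^ 2 * X 3 - X 0 ^ 2 * X 4
/-- The cubic `F₅`. -/
def F5 : CoordRing 5 := X 1 ^ 2 * X 3 - X 4 * X 5 ^ 2
/-- The cubic `F₆`. -/
def F6 : CoordRing 5 := X 1 * X 2 ^ 2 - X 0 * X 4 ^ 2
/-- The cubic `F₇`. -/
def F7 : CoordRing 5 := X 1 ^ 2 * X 2 - X 4 ^ 2 * X 5

/-- The cubic `A'₁`. -/
def A1' : CoordRing 5 := F1 + F2 - F6 - F7
/-- The cubic `A'₂`. -/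
def A2' : CoordRing 5 := F2 - F3 + F5 - F6

/-- The ideal `(A'₁, A'₂)` that defines `Y'` as a subscheme of `ℙ⁵`. -/
def idealY' : Ideal (CoordRing 5) := Ideal.span {A1', A2'}

/-- The (points of the) threefold `Y' ⊆ ℙ⁵`. -/
def Y' : Set (ProjSpace 5) := zeroSet idealY'

end

/-! Put a = (v₁, v₂, v₃) and b = (v₀, v₅, v₄). The variables separate: A'₁ = F(a) + F(b) and A'₂ =
G(a) + G(b), where F and G (`pencilF`, `pencilG`) span a pencil of plane cubics, and everything is
read off from this pencil. With p = -m, q = -l, r = l + m the member lF + mG is r x(z² - y²) + q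
y(x² - z²) + p z(y² - x²), where p + q + r = 0. It can be singular only if pqr(p - q)(q - r)(r - p)
= 0. This gives six members, each a line L and a conic Q that meet transversally in two points, none
of which is a base point of the pencil (`discriminant_eq_zero`, `exists_node_of_isCritical`).

A point (a, b) of Y' is singular iff the gradient of one and the same member vanishes at a and at b.
Neither part is zero, since the other one would then be a node in the base locus. So both parts are
multiples of nodes of one reducible member. The equation of this member holds automatically, and a
second member fixes the cube of the ratio of the two multiples. The count is 6 · 2 · 2 · 3 = 72
(`singularLocus_eq_range`).

Near such a point the reducible member has the equation L(a)Q(a) + L(b)Q(b) = 0, a sum of four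
squares of combinations of the L and Q. These four functions, the second equation and the equation
of the chart are local coordinates of affine 6-space (`dirDeriv_eq_zero_of_tangent`), so
`nonempty_adicCompletion_algEquiv` identifies the complete local ring with that of a node.

The same factorization yields the surfaces: L(a) = L(b) = 0 kills the reducible member and leaves in
a ℙ³ the smooth cubic surface u³ - uw² + u'³ - u'w'² = 0, the same for all six members. The sequence
is regular because A'₁ is irreducible (Eisenstein) and does not divide A'₂. Both cubics vanish on
the parametrization of the del Pezzo surface. The automorphism of order six exchanges a and b and
rotates their coordinates, which preserves the pencil. -/

/-! ### Completions presented by complete rings -/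

section Completion

variable {k A R : Type*} [CommRing k] [CommRing A] [Algebra k A] [CommRing R] [Algebra k R]

/-- If `A` is a complete Noetherian ring and the rings `R ⧸ m ^ n` are, compatibly, the quotients
of `A` by `N ^ n ⊔ q`, then the completion of `R` is `A ⧸ q`. -/
theorem AdicCompletion.nonempty_algEquiv_quotient [IsNoetherianRing A] (N q : Ideal A)
    [IsAdicComplete N A] (m : Ideal R) (χ : (n : ℕ) → A →ₐ[k] R ⧸ m ^ n)
    (hχ : ∀ {i j : ℕ} (h : i ≤ j),
      (Ideal.Quotient.factorₐ k (Ideal.pow_le_pow_right h)).comp (χ j) = χ i)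
    (hsurj : ∀ n, Function.Surjective (χ n))
    (hker : ∀ n x, χ n x = 0 ↔ x ∈ N ^ n ⊔ q) :
    Nonempty (AdicCompletion m R ≃ₐ[k] A ⧸ q) := by
  let ψ : A →ₐ[k] AdicCompletion m R := AdicCompletion.liftAlgHom m χ hχ
  have hψ : ∀ n x, AdicCompletion.evalₐ m n (ψ x) = χ n x := fun n x =>
    AdicCompletion.evalₐ_liftAlgHom m χ hχ n x
  have hχ' : ∀ {i j : ℕ} (h : i ≤ j) (x : A),
      Ideal.Quotient.factorₐ k (Ideal.pow_le_pow_right h) (χ j x) = χ i x := fun h x =>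
    DFunLike.congr_fun (hχ h) x
  have hkerψ : RingHom.ker ψ = q := by
    ext x
    rw [RingHom.mem_ker]
    constructor
    · intro hx
      -- The ideal `q` is closed: `N` lies in the Jacobson radical of the Noetherian ring `A`, so `A
      -- ⧸ q` is separated by Krull's theorem.
      have hH : IsHausdorff N (A ⧸ q) :=
        IsHausdorff.of_le_jacobson N (A ⧸ q) (IsAdicComplete.le_jacobson_bot N)
      rw [← Ideal.Quotient.eq_zero_iff_mem]
      refine hH.haus _ fun n => ?_
      rw [SModEq.zero]
      have h1 : x ∈ N ^ n ⊔ q := by rw [← hker, ← hψ, hx, _root_.map_zero]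
      obtain ⟨y, hy, z, hz, rfl⟩ := Submodule.mem_sup.mp h1
      rw [map_add, Ideal.Quotient.eq_zero_iff_mem.mpr hz, add_zero]
      have h2 : (Ideal.Quotient.mk q) y = y • (1 : A ⧸ q) := by
        rw [Algebra.smul_def, mul_one]; rfl
      rw [h2]
      exact Submodule.smul_mem_smul hy trivial
    · intro hx
      refine AdicCompletion.ext_evalₐ fun n => ?_
      rw [hψ, _root_.map_zero, hker]
      exact Ideal.mem_sup_right hx
  have hsψ : Function.Surjective ψ := by
    intro y
    -- An approximate preimage at level n can be corrected to level n + 1. The error lies in `N ^ n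
    -- ⊔ q`; its component in `q` dies at every level and is dropped, so that the correction lies in
    -- `N ^ n` and the corrections converge.
    have step : ∀ (n : ℕ) (s : A), χ n s = AdicCompletion.evalₐ m n y →
        ∃ s' : A, χ (n + 1) s' = AdicCompletion.evalₐ m (n + 1) y ∧ s' - s ∈ N ^ n := by
      intro n s hs
      obtain ⟨t, ht⟩ := hsurj (n + 1) (AdicCompletion.evalₐ m (n + 1) y)
      have h1 : χ n (t - s) = 0 := by
        rw [map_sub, hs, ← hχ' n.le_succ, ht, sub_eq_zero]
        obtain ⟨c, rfl⟩ := AdicCompletion.mk_surjective m R y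
        rw [AdicCompletion.evalₐ_mk, AdicCompletion.evalₐ_mk]
        have := c.2 n.le_succ
        change (Ideal.Quotient.factor (Ideal.pow_le_pow_right n.le_succ)) (Ideal.Quotient.mk _ _) = _
        rw [Ideal.Quotient.factor_mk]
        rw [SModEq.sub_mem, smul_eq_mul, Ideal.mul_top] at this
        rw [Ideal.Quotient.eq, ← neg_mem_iff, neg_sub]
        exact this
      obtain ⟨u, hu, v, hv, huv⟩ := Submodule.mem_sup.mp ((hker n _).mp h1)
      refine ⟨s + u, ?_, by simpa using hu⟩
      have h2 : s + u = t - v := by linear_combination huv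
      rw [h2, map_sub, (hker (n + 1) v).mpr (Ideal.mem_sup_right hv), sub_zero, ht]
    obtain ⟨s0, hs0⟩ := hsurj 0 (AdicCompletion.evalₐ m 0 y)
    let s : (n : ℕ) → {s : A // χ n s = AdicCompletion.evalₐ m n y} := fun n =>
      Nat.rec ⟨s0, hs0⟩ (fun n s => ⟨(step n s.1 s.2).choose, (step n s.1 s.2).choose_spec.1⟩) n
    have hs : ∀ n, (s (n + 1)).1 - (s n).1 ∈ N ^ n := fun n =>
      (step n (s n).1 (s n).2).choose_spec.2
    have hcauchy : ∀ {i j : ℕ}, i ≤ j → (s i).1 ≡ (s j).1 [SMOD (N ^ i • ⊤ : Submodule A A)] := by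
      intro i j hij
      induction j, hij using Nat.le_induction with
      | base => rfl
      | succ j hij ih =>
        refine ih.trans ?_
        rw [SModEq.comm, SModEq.sub_mem, smul_eq_mul, Ideal.mul_top]
        exact Ideal.pow_le_pow_right hij (hs j)
    obtain ⟨l, hl⟩ := IsPrecomplete.prec' (I := N) (fun n => (s n).1) hcauchy
    refine ⟨l, AdicCompletion.ext_evalₐ fun n => ?_⟩
    have h1 := hl n
    rw [SModEq.sub_mem, smul_eq_mul, Ideal.mul_top] at h1
    have h2 := (hker n _).mpr (Ideal.mem_sup_left (T := q) h1)
    rw [map_sub, sub_eq_zero] at h2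
    rw [hψ, ← h2, (s n).2]
  exact ⟨((Ideal.quotientEquivAlgOfEq k hkerψ.symm).trans
    (Ideal.quotientKerAlgEquivOfSurjective hsψ)).symm⟩

end Completion

/-! ### Polynomials and power series modulo powers of the ideal of the origin -/

section PowerSeries

variable {σ K : Type*} [Finite σ] [CommRing K]

/-- A power series whose coefficients in degrees below `n` vanish lies in the `n`-th power of the
ideal generated by the variables. -/
theorem MvPowerSeries.mem_span_X_pow_of_truncTotal_eq_zero (n : ℕ) (f : MvPowerSeries σ K)
    (hf : f.truncTotal n = 0) :
    f ∈ (Ideal.span (Set.range (X : σ → MvPowerSeries σ K))) ^ n := by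
  -- In the completion of the polynomial ring, the kernel of the projection to level n is the n-th
  -- power of the extended ideal, because the ideal of the variables is finitely generated.
  let e := (toAdicCompletionAlgEquiv σ K).toRingEquiv
  have hmap : Ideal.map e (Ideal.span (Set.range X)) =
      (MvPolynomial.idealOfVars σ K).map (algebraMap (MvPolynomial σ K) (AdicCompletion
        (MvPolynomial.idealOfVars σ K) (MvPolynomial σ K))) := by
    simp_rw [Ideal.map_span, ← Set.range_comp]
    congr 2; ext1
    simp [e, AdicCompletion.algebraMap_apply, ← MvPolynomial.coe_X, toAdicCompletion_coe]
  have h1 : e f ∈ LinearMap.ker (AdicCompletion.eval (MvPolynomial.idealOfVars σ K)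
      (MvPolynomial σ K) n) := by
    rw [LinearMap.mem_ker]
    change (toAdicCompletion σ K f).val n = 0
    rw [toAdicCompletion_apply_eq_mk_truncTotal, hf]
    rfl
  rw [← AdicCompletion.pow_smul_top_eq_ker_eval (MvPolynomial.idealOfVars_fg σ K)] at h1
  have h2 : e f ∈ Ideal.map e (Ideal.span (Set.range X) ^ n) := by
    rw [Ideal.map_pow, hmap, ← Ideal.map_pow]
    rw [← Submodule.restrictScalars_mem (MvPolynomial σ K), ← Ideal.mul_top (Ideal.map _ _),
      ← smul_eq_mul]
    rw [Ideal.smul_restrictScalars]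
    exact h1
  exact (Ideal.mem_map_of_equiv e _).mp h2 |>.elim fun x hx => (e.injective hx.2) ▸ hx.1

end PowerSeries

/-! ### Polynomial maps with invertible Jacobian matrix -/

namespace MvPolynomial

/-! ### Polynomial maps that fix the origin, modulo powers of its ideal -/

section Origin

variable {υ K : Type*} [Field K]

theorem sub_C_constantCoeff_mem_idealOfVars (g : MvPolynomial υ K) :
    g - C (constantCoeff g) ∈ idealOfVars υ K := by
  rw [← pow_one (idealOfVars υ K), mem_pow_idealOfVars_iff']
  intro d hd
  have : d = 0 := by
    rw [← Finsupp.degree_eq_zero_iff]; omega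
  subst this
  simp [constantCoeff_eq]

theorem aeval_mem_idealOfVars_pow {σ : Type*} {φ : σ → MvPolynomial υ K}
    {I : Ideal (MvPolynomial υ K)} (hφ : ∀ s, φ s ∈ I) (n : ℕ) {f : MvPolynomial σ K}
    (hf : f ∈ idealOfVars σ K ^ n) : aeval φ f ∈ I ^ n := by
  have h1 : Ideal.map (aeval φ : MvPolynomial σ K →ₐ[K] _) (idealOfVars σ K) ≤ I := by
    rw [Ideal.map_span, Ideal.span_le]
    rintro _ ⟨_, ⟨s, rfl⟩, rfl⟩
    simpa using hφ s
  have h2 := Ideal.mem_map_of_mem (aeval φ : MvPolynomial σ K →ₐ[K] MvPolynomial υ K) hf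
  rw [Ideal.map_pow] at h2
  exact Ideal.pow_right_mono h1 n h2

/-- Only the finitely many coefficients in degrees below n survive. The finite dimension serves to
deduce injectivity from surjectivity. -/
instance finiteDimensional_quotient_idealOfVars_pow [Finite υ] (n : ℕ) :
    FiniteDimensional K (MvPolynomial υ K ⧸ (idealOfVars υ K ^ n).restrictScalars K) := by
  have hfin : Finite {d : υ →₀ ℕ // d.degree < n} :=
    (Finsupp.finite_of_degree_le n).subset fun d (hd : d.degree < n) => hd.le
  let T : MvPolynomial υ K →ₗ[K] ({d : υ →₀ ℕ // d.degree < n} → K) :=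
    LinearMap.pi fun d => lcoeff K d.1
  have hT : (idealOfVars υ K ^ n).restrictScalars K = LinearMap.ker T := by
    ext g
    rw [Submodule.restrictScalars_mem, mem_pow_idealOfVars_iff', LinearMap.mem_ker]
    constructor
    · intro h; funext d; exact h d.1 d.2
    · intro h d hd; exact congrFun h ⟨d, hd⟩
  rw [hT]
  exact Module.Finite.equiv (LinearMap.quotKerEquivRange T).symm

variable {φ : υ → MvPolynomial υ K}

/-- Surjectivity on the graded pieces follows from degree one: if f approximates x to order n and f₂
approximates y to order 1, then f * f₂ approximates x * y to order n + 1. -/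
theorem exists_sub_aeval_mem_idealOfVars_pow_succ (hφ : ∀ s, φ s ∈ idealOfVars υ K)
    (hX : ∀ j, ∃ f ∈ idealOfVars υ K, X j - aeval φ f ∈ idealOfVars υ K ^ 2) (n : ℕ) :
    ∀ g ∈ idealOfVars υ K ^ n, ∃ f ∈ idealOfVars υ K ^ n,
      g - aeval φ f ∈ idealOfVars υ K ^ (n + 1) := by
  induction n with
  | zero =>
    intro g _
    refine ⟨C (constantCoeff g), by simp, ?_⟩
    simpa using sub_C_constantCoeff_mem_idealOfVars g
  | succ n ih =>
    intro g hg
    rw [pow_succ] at hg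
    have h1 : ∀ y ∈ idealOfVars υ K, ∃ f ∈ idealOfVars υ K,
        y - aeval φ f ∈ idealOfVars υ K ^ 2 := by
      intro y hy
      induction hy using Submodule.span_induction with
      | mem y hy => obtain ⟨j, rfl⟩ := hy; exact hX j
      | zero => exact ⟨0, zero_mem _, by simp⟩
      | add y z _ _ hy hz =>
        obtain ⟨f, hf, hf'⟩ := hy
        obtain ⟨f₂, hf₂, hf₂'⟩ := hz
        refine ⟨f + f₂, add_mem hf hf₂, ?_⟩
        have := add_mem hf' hf₂'
        rwa [map_add, add_sub_add_comm]
      | smul a y hy ih =>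
        obtain ⟨f, hf, hf'⟩ := ih
        -- Modulo the square of the ideal only the constant term of the coefficient matters.
        refine ⟨C (constantCoeff a) * f, Ideal.mul_mem_left _ _ hf, ?_⟩
        have h2 : a • y - aeval φ (C (constantCoeff a) * f) =
            (a - C (constantCoeff a)) * y + C (constantCoeff a) * (y - aeval φ f) := by
          simp only [smul_eq_mul, map_mul, algHom_C, algebraMap_eq]; ring
        rw [h2]
        refine add_mem ?_ (Ideal.mul_mem_left _ _ hf')
        rw [pow_two]
        exact Ideal.mul_mem_mul (sub_C_constantCoeff_mem_idealOfVars a) hy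
    induction hg using Submodule.mul_induction_on' with
    | mem_mul_mem x hx y hy =>
      obtain ⟨f, hf, hf'⟩ := ih x hx
      obtain ⟨f₂, hf₂, hf₂'⟩ := h1 y hy
      refine ⟨f * f₂, by rw [pow_succ]; exact Ideal.mul_mem_mul hf hf₂, ?_⟩
      have h2 : x * y - aeval φ (f * f₂) = (x - aeval φ f) * y + aeval φ f * (y - aeval φ f₂) := by
        rw [map_mul]; ring
      rw [h2]
      refine add_mem ?_ ?_
      · rw [pow_succ]; exact Ideal.mul_mem_mul hf' hy
      · rw [show n + 1 + 1 = n + 2 from rfl, pow_add]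
        exact Ideal.mul_mem_mul (aeval_mem_idealOfVars_pow hφ n hf) hf₂'
    | add x _ y _ hx hy =>
      obtain ⟨f, hf, hf'⟩ := hx
      obtain ⟨f₂, hf₂, hf₂'⟩ := hy
      refine ⟨f + f₂, add_mem hf hf₂, ?_⟩
      have := add_mem hf' hf₂'
      rwa [map_add, add_sub_add_comm]

theorem exists_sub_aeval_mem_idealOfVars_pow (hφ : ∀ s, φ s ∈ idealOfVars υ K)
    (hX : ∀ j, ∃ f ∈ idealOfVars υ K, X j - aeval φ f ∈ idealOfVars υ K ^ 2) (n : ℕ)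
    (g : MvPolynomial υ K) : ∃ f : MvPolynomial υ K, g - aeval φ f ∈ idealOfVars υ K ^ n := by
  induction n with
  | zero => exact ⟨0, by simp⟩
  | succ n ih =>
    obtain ⟨f, hf⟩ := ih
    obtain ⟨f₂, _, hf₂'⟩ := exists_sub_aeval_mem_idealOfVars_pow_succ hφ hX n _ hf
    exact ⟨f + f₂, by rwa [map_add, ← sub_sub]⟩

/-- A polynomial map that fixes the origin and is invertible there to first order is injective
modulo each power of the ideal of the origin. -/
theorem mem_idealOfVars_pow_of_aeval_mem [Finite υ] (hφ : ∀ s, φ s ∈ idealOfVars υ K)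
    (hX : ∀ j, ∃ f ∈ idealOfVars υ K, X j - aeval φ f ∈ idealOfVars υ K ^ 2) (n : ℕ)
    {f : MvPolynomial υ K} (hf : aeval φ f ∈ idealOfVars υ K ^ n) : f ∈ idealOfVars υ K ^ n := by
  let V := (idealOfVars υ K ^ n).restrictScalars K
  let θ : (MvPolynomial υ K ⧸ V) →ₗ[K] (MvPolynomial υ K ⧸ V) :=
    V.mapQ V (aeval φ).toLinearMap fun g hg => aeval_mem_idealOfVars_pow hφ n hg
  have hθ : Function.Surjective θ := by
    intro z
    obtain ⟨g, rfl⟩ := Submodule.Quotient.mk_surjective V z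
    obtain ⟨f, hf⟩ := exists_sub_aeval_mem_idealOfVars_pow hφ hX n g
    refine ⟨Submodule.Quotient.mk f, ?_⟩
    exact ((Submodule.Quotient.eq V).mpr hf).symm
  -- A surjective endomorphism of a finite-dimensional space is injective.
  have hinj : Function.Injective θ := LinearMap.injective_iff_surjective.mpr hθ
  have h0 : θ (Submodule.Quotient.mk f) = 0 := (Submodule.Quotient.mk_eq_zero V).mpr hf
  have := hinj (h0.trans (map_zero θ).symm)
  exact (Submodule.Quotient.mk_eq_zero V).mp this

end Origin

/-! ### Moving a point to the origin -/

section Point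

variable {υ K : Type*} [Field K]

/-- The automorphism of the polynomial ring that moves the origin to `w`. -/
noncomputable def translate (w : υ → K) : MvPolynomial υ K ≃ₐ[K] MvPolynomial υ K :=
  AlgEquiv.ofAlgHom (aeval fun j => X j + C (w j)) (aeval fun j => X j - C (w j))
    (by ext j; simp) (by ext j; simp)

@[simp] theorem translate_X (w : υ → K) (j : υ) : translate w (X j) = X j + C (w j) := by
  simp [translate]

theorem constantCoeff_translate (w : υ → K) (g : MvPolynomial υ K) :
    constantCoeff (translate w g) = eval w g := by
  induction g using MvPolynomial.induction_on with
  | C a => simp [translate]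
  | add p q hp hq => simp [hp, hq]
  | mul_X p i hp => simp [hp]

theorem mem_vanishingIdeal_singleton {w : υ → K} {g : MvPolynomial υ K} :
    g ∈ vanishingIdeal K {w} ↔ eval w g = 0 := by
  rw [mem_vanishingIdeal_singleton_iff, aeval_eq_eval]

theorem aeval_translate_comp {φ : υ → MvPolynomial υ K} {w : υ → K}
    (f : MvPolynomial υ K) :
    aeval (fun s => translate w (φ s)) f = translate w (aeval φ f) := by
  have : (aeval fun s => translate w (φ s)) = ((translate w).toAlgHom).comp (aeval φ) := by
    ext s; simp
  rw [this]; rfl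

theorem map_translate_vanishingIdeal (w : υ → K) :
    Ideal.map (translate w).toRingEquiv (vanishingIdeal K {w}) = idealOfVars υ K := by
  ext g
  rw [Ideal.mem_map_of_equiv]
  constructor
  · rintro ⟨f, hf, rfl⟩
    have h := sub_C_constantCoeff_mem_idealOfVars (translate w f)
    rw [mem_vanishingIdeal_singleton_iff] at hf
    rw [constantCoeff_translate] at h
    rw [aeval_eq_eval] at hf
    simpa [hf] using h
  · intro hg
    refine ⟨(translate w).symm g, ?_, by simp⟩
    rw [mem_vanishingIdeal_singleton_iff, aeval_eq_eval]
    rw [← constantCoeff_translate, AlgEquiv.apply_symm_apply]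
    rw [← pow_one (idealOfVars υ K), mem_pow_idealOfVars_iff'] at hg
    exact hg 0 (by simp)

theorem mem_vanishingIdeal_pow_iff (w : υ → K) (n : ℕ) (g : MvPolynomial υ K) :
    g ∈ vanishingIdeal K {w} ^ n ↔ translate w g ∈ idealOfVars υ K ^ n := by
  rw [← map_translate_vanishingIdeal w, ← Ideal.map_pow, Ideal.mem_map_of_equiv]
  exact ⟨fun h => ⟨g, h, rfl⟩, fun ⟨f, hf, h⟩ => (translate w).injective h ▸ hf⟩

theorem translate_comp_mem {φ : υ → MvPolynomial υ K} {w : υ → K}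
    (hw : ∀ s, eval w (φ s) = 0) (s : υ) :
    translate w (φ s) ∈ idealOfVars υ K := by
  have := (mem_vanishingIdeal_pow_iff w 1 (φ s)).mp
    (by rw [pow_one]; exact mem_vanishingIdeal_singleton.mpr (hw s))
  rwa [pow_one] at this

end Point

/-! ### Directional derivatives and invertible Jacobian matrices at a point -/

section Jacobian

variable {υ K : Type*} [Fintype υ] [Field K]

/-- The derivative of `F` at `w` in the direction `d`. -/
noncomputable def dirDeriv (w d : υ → K) (F : MvPolynomial υ K) : K :=
  ∑ j, eval w (pderiv j F) * d j

section

variable (w d : υ → K)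

@[simp] theorem dirDeriv_C (a : K) : dirDeriv w d (C a) = 0 := by simp [dirDeriv]

@[simp] theorem dirDeriv_one : dirDeriv w d 1 = 0 := by simp [dirDeriv]

@[simp] theorem dirDeriv_X (j : υ) : dirDeriv w d (X j) = d j := by
  classical
  simp [dirDeriv, pderiv_X, Pi.single_apply]

@[simp] theorem dirDeriv_add (F G : MvPolynomial υ K) :
    dirDeriv w d (F + G) = dirDeriv w d F + dirDeriv w d G := by
  simp [dirDeriv, add_mul, Finset.sum_add_distrib]

@[simp] theorem dirDeriv_sub (F G : MvPolynomial υ K) :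
    dirDeriv w d (F - G) = dirDeriv w d F - dirDeriv w d G := by
  simp [dirDeriv, sub_mul, Finset.sum_sub_distrib]

@[simp] theorem dirDeriv_mul (F G : MvPolynomial υ K) :
    dirDeriv w d (F * G) = eval w F * dirDeriv w d G + eval w G * dirDeriv w d F := by
  simp only [dirDeriv, Finset.mul_sum, ← Finset.sum_add_distrib]
  refine Finset.sum_congr rfl fun j _ => ?_
  simp; ring

end

/-- The Taylor expansion of order one. -/
theorem sub_linear_mem_vanishingIdeal_sq (w : υ → K) (F : MvPolynomial υ K) :
    F - C (eval w F) - ∑ j, C (eval w (pderiv j F)) * (X j - C (w j)) ∈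
      vanishingIdeal K {w} ^ 2 := by
  classical
  induction F using MvPolynomial.induction_on with
  | C a => simp
  | add p q hp hq =>
    have := add_mem hp hq
    simp only [map_add, add_mul, Finset.sum_add_distrib]
    convert! this using 1
    ring
  | mul_X p i hp =>
    have h1 : (p - C (eval w p)) * (X i - C (w i)) ∈ vanishingIdeal K {w} ^ 2 := by
      rw [pow_two]
      exact Ideal.mul_mem_mul (mem_vanishingIdeal_singleton.mpr (by simp))
        (mem_vanishingIdeal_singleton.mpr (by simp))
    have h2 := add_mem (Ideal.mul_mem_left _ (C (w i)) hp) h1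
    convert! h2 using 1
    have h3 : ∑ j, C (eval w (pderiv j (p * X i))) * (X j - C (w j)) =
        C (w i) * ∑ j, C (eval w (pderiv j p)) * (X j - C (w j)) +
          C (eval w p) * (X i - C (w i)) := by
      have h4 : ∀ j, C (eval w (pderiv j (p * X i))) * (X j - C (w j)) =
          C (w i) * (C (eval w (pderiv j p)) * (X j - C (w j))) +
            (if j = i then C (eval w p) * (X i - C (w i)) else 0) := by
        intro j
        by_cases h : j = i
        · subst h; simp [add_mul]; ring
        · simp [pderiv_X, h, Ne.symm h]; ring
      rw [Finset.sum_congr rfl fun j _ => h4 j, Finset.sum_add_distrib, Finset.mul_sum]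
      simp
    rw [h3]
    simp only [map_mul, eval_X]
    ring

variable {φ : υ → MvPolynomial υ K} {w : υ → K}

/-- The Jacobian matrix has trivial kernel, hence is invertible, and some row c satisfies c · J =
e_j. By the Taylor expansion the linear form with coefficients c reproduces the j-th coordinate to
first order. -/
theorem exists_X_sub_aeval_mem_sq
    (hw : ∀ s, eval w (φ s) = 0)
    (hJ : ∀ d : υ → K, (∀ s, dirDeriv w d (φ s) = 0) → d = 0) (j : υ) :
    ∃ f ∈ idealOfVars υ K, (X j - C (w j)) - aeval φ f ∈ vanishingIdeal K {w} ^ 2 := by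
  classical
  let A : Matrix υ υ K := Matrix.of fun s i => eval w (pderiv i (φ s))
  have hA : IsUnit A := by
    rw [← Matrix.mulVec_injective_iff_isUnit]
    intro d e hde
    rw [← sub_eq_zero]
    refine hJ _ fun s => ?_
    have h1 : A.mulVec (d - e) s = 0 := by
      have : A.mulVec d = A.mulVec e := hde
      rw [Matrix.mulVec_sub, this, sub_self]; rfl
    exact h1
  obtain ⟨c, hc⟩ := (Matrix.vecMul_surjective_iff_isUnit.mpr hA) (Pi.single j 1)
  refine ⟨∑ s, C (c s) * X s, sum_mem fun s _ => Ideal.mul_mem_left _ _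
    (Ideal.subset_span ⟨s, rfl⟩), ?_⟩
  have h1 : ∑ s, C (c s) * (φ s - C (eval w (φ s)) -
      ∑ i, C (eval w (pderiv i (φ s))) * (X i - C (w i))) ∈ vanishingIdeal K {w} ^ 2 :=
    sum_mem fun s _ => Ideal.mul_mem_left _ _ (sub_linear_mem_vanishingIdeal_sq w (φ s))
  have h2 : ∑ s, C (c s) * ∑ i, C (eval w (pderiv i (φ s))) * (X i - C (w i)) =
      X j - C (w j) := by
    simp_rw [Finset.mul_sum]
    rw [Finset.sum_comm]
    have h3 : ∀ i, ∑ s, C (c s) * (C (eval w (pderiv i (φ s))) * (X i - C (w i))) =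
        C ((Pi.single j 1 : υ → K) i) * (X i - C (w i)) := by
      intro i
      rw [← hc]
      simp only [Matrix.vecMul, dotProduct, map_sum, Finset.sum_mul, A, Matrix.of_apply, map_mul,
        mul_assoc]
    rw [Finset.sum_congr rfl fun i _ => h3 i, Finset.sum_eq_single j]
    · simp
    · intro i _ hi; simp [hi]
    · simp
  rw [← neg_mem_iff]
  convert! h1 using 1
  simp only [hw, map_zero, sub_zero, mul_sub, Finset.sum_sub_distrib, map_sum, map_mul, aeval_X,
    algHom_C, algebraMap_eq] at h2 ⊢
  rw [h2]
  ring

theorem exists_X_sub_aeval_translate (hw : ∀ s, eval w (φ s) = 0)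
    (hJ : ∀ d : υ → K, (∀ s, dirDeriv w d (φ s) = 0) → d = 0) (j : υ) :
    ∃ f ∈ idealOfVars υ K,
      X j - aeval (fun s => translate w (φ s)) f ∈ idealOfVars υ K ^ 2 := by
  obtain ⟨f, hf, h⟩ := exists_X_sub_aeval_mem_sq hw hJ j
  refine ⟨f, hf, ?_⟩
  rw [mem_vanishingIdeal_pow_iff, map_sub] at h
  rw [aeval_translate_comp]
  convert! h using 2
  rw [map_sub, translate_X, ← algebraMap_eq, AlgEquiv.commutes, add_sub_cancel_right]

/-- A polynomial map with invertible Jacobian matrix at `w` that maps `w` to the origin is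
bijective modulo each power of the ideals of the two points: surjectivity. -/
theorem exists_sub_aeval_mem_vanishingIdeal_pow (hw : ∀ s, eval w (φ s) = 0)
    (hJ : ∀ d : υ → K, (∀ s, dirDeriv w d (φ s) = 0) → d = 0) (n : ℕ) (g : MvPolynomial υ K) :
    ∃ f : MvPolynomial υ K, g - aeval φ f ∈ vanishingIdeal K {w} ^ n := by
  obtain ⟨f, hf⟩ := exists_sub_aeval_mem_idealOfVars_pow (translate_comp_mem hw)
    (exists_X_sub_aeval_translate hw hJ) n (translate w g)
  refine ⟨f, ?_⟩
  rwa [mem_vanishingIdeal_pow_iff, map_sub, ← aeval_translate_comp]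

/-- A polynomial map with invertible Jacobian matrix at `w` that maps `w` to the origin is
bijective modulo each power of the ideals of the two points: injectivity. -/
theorem mem_idealOfVars_pow_of_aeval_mem_vanishingIdeal_pow (hw : ∀ s, eval w (φ s) = 0)
    (hJ : ∀ d : υ → K, (∀ s, dirDeriv w d (φ s) = 0) → d = 0) (n : ℕ) {f : MvPolynomial υ K}
    (hf : aeval φ f ∈ vanishingIdeal K {w} ^ n) : f ∈ idealOfVars υ K ^ n := by
  rw [mem_vanishingIdeal_pow_iff, ← aeval_translate_comp] at hf
  exact mem_idealOfVars_pow_of_aeval_mem (translate_comp_mem hw)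
    (exists_X_sub_aeval_translate hw hJ) n hf

end Jacobian

end MvPolynomial

/-! ### The completion of a complete intersection in terms of local coordinates -/

theorem Ideal.apply_eq_zero_of_mem_span_pow {k A B ι : Type*} [CommRing k] [CommRing A]
    [CommRing B] [Algebra k A] [Algebra k B] {J : Ideal B} (n : ℕ) (χ : A →ₐ[k] B ⧸ J ^ n)
    (a : ι → A) (h : ∀ i, χ (a i) ∈ Ideal.map (Ideal.Quotient.mk (J ^ n)) J) {f : A}
    (hf : f ∈ Ideal.span (Set.range a) ^ n) : χ f = 0 := by
  have h1 : Ideal.span (Set.range a) ≤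
      Ideal.comap χ (Ideal.map (Ideal.Quotient.mk (J ^ n)) J) := by
    rw [Ideal.span_le]
    rintro _ ⟨i, rfl⟩
    exact h i
  have h2 := (Ideal.pow_right_mono h1 n).trans (Ideal.le_comap_pow χ n) hf
  rwa [← Ideal.map_pow, Ideal.map_quotient_self, Ideal.mem_comap, Ideal.mem_bot] at h2

namespace MvPolynomial

section LocalCoordinates

variable {σ τ υ K : Type*} [Fintype υ] [Field K]
  {x : σ → MvPolynomial υ K} {y : τ → MvPolynomial υ K} {w : υ → K}

/-- Let `x, y` be local coordinates at `w`. A polynomial in the `x` that lies in the ideal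
generated by `q(x)` and the `y`, up to the `n`-th power of the ideal of `w`, is a multiple of `q`
up to terms of order `n`. -/
theorem mem_sup_of_aeval_mem (e : σ ⊕ τ ≃ υ) (hx : ∀ s, eval w (x s) = 0)
    (hy : ∀ t, eval w (y t) = 0)
    (hJ : ∀ d : υ → K, (∀ s, dirDeriv w d (x s) = 0) → (∀ t, dirDeriv w d (y t) = 0) → d = 0)
    (q : MvPolynomial σ K) (n : ℕ) {p : MvPolynomial σ K}
    (hp : aeval x p ∈ vanishingIdeal K {w} ^ n ⊔
      (Ideal.span {aeval x q} ⊔ Ideal.span (Set.range y))) :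
    p ∈ idealOfVars σ K ^ n ⊔ Ideal.span {q} := by
  let φ : υ → MvPolynomial υ K := fun j => Sum.elim x y (e.symm j)
  have hφ : ∀ j, eval w (φ j) = 0 := by
    intro j
    rcases h : e.symm j with s | t <;> simp [φ, h, hx, hy]
  have hφJ : ∀ d : υ → K, (∀ j, dirDeriv w d (φ j) = 0) → d = 0 := fun d hd =>
    hJ d (fun s => by simpa [φ] using hd (e (Sum.inl s)))
      (fun t => by simpa [φ] using hd (e (Sum.inr t)))
  let ι : MvPolynomial σ K →ₐ[K] MvPolynomial υ K := rename fun s => e (Sum.inl s)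
  -- Setting the variables of the `y` to zero is a retraction of `ι` that maps the ideal `𝔞` below
  -- into the ideal of `q`.
  let ρ : MvPolynomial υ K →ₐ[K] MvPolynomial σ K :=
    aeval fun j => Sum.elim X (fun _ => 0) (e.symm j)
  have hρι : ∀ f, ρ (ι f) = f := fun f => by
    have : ρ.comp ι = AlgHom.id K _ := by ext s; simp [ρ, ι]
    exact DFunLike.congr_fun this f
  have hι : ∀ f, aeval φ (ι f) = aeval x f := fun f => by
    simp only [ι, aeval_rename]
    congr 1
    simp [φ, Function.comp_def]
  let m := vanishingIdeal K {w}
  let 𝔞 : Ideal (MvPolynomial υ K) :=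
    Ideal.span {ι q} ⊔ Ideal.span (Set.range fun t => X (e (Sum.inr t)))
  -- elements of the ideal are, modulo `m ^ n`, values at `φ` of elements of `𝔞`
  have key : ∀ g ∈ Ideal.span {aeval x q} ⊔ Ideal.span (Set.range y),
      ∃ f ∈ 𝔞, g - aeval φ f ∈ m ^ n := by
    intro g hg
    rw [← Ideal.span_union] at hg
    induction hg using Submodule.span_induction with
    | mem g hg =>
      rcases hg with rfl | ⟨t, rfl⟩
      · exact ⟨ι q, Ideal.mem_sup_left (Ideal.mem_span_singleton_self _), by
          rw [hι, sub_self]; exact zero_mem _⟩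
      · exact ⟨X (e (Sum.inr t)), Ideal.mem_sup_right (Ideal.subset_span ⟨t, rfl⟩),
          by simp [φ]⟩
    | zero => exact ⟨0, zero_mem _, by simp⟩
    | add g h _ _ hg hh =>
      obtain ⟨f, hf, hf'⟩ := hg
      obtain ⟨f₂, hf₂, hf₂'⟩ := hh
      refine ⟨f + f₂, add_mem hf hf₂, ?_⟩
      have := add_mem hf' hf₂'
      rwa [map_add, add_sub_add_comm]
    | smul a g _ hg =>
      obtain ⟨f, hf, hf'⟩ := hg
      obtain ⟨b, hb⟩ := exists_sub_aeval_mem_vanishingIdeal_pow hφ hφJ n a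
      refine ⟨b * f, Ideal.mul_mem_left _ _ hf, ?_⟩
      have h1 : a • g - aeval φ (b * f) =
          a * (g - aeval φ f) + aeval φ f * (a - aeval φ b) := by
        rw [map_mul, smul_eq_mul]; ring
      rw [h1]
      exact add_mem (Ideal.mul_mem_left _ _ hf') (Ideal.mul_mem_left _ _ hb)
  obtain ⟨u, hu, g, hg, hug⟩ := Submodule.mem_sup.mp hp
  obtain ⟨f, hf, hf'⟩ := key g hg
  have h1 : ι p - f ∈ idealOfVars υ K ^ n := by
    refine mem_idealOfVars_pow_of_aeval_mem_vanishingIdeal_pow hφ hφJ n ?_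
    rw [map_sub, hι, ← hug, add_sub_assoc]
    exact add_mem hu hf'
  have h2 : ρ (ι p - f) ∈ idealOfVars σ K ^ n := by
    refine aeval_mem_idealOfVars_pow (fun j => ?_) n h1
    rcases e.symm j with s | t
    · exact Ideal.subset_span ⟨s, rfl⟩
    · exact zero_mem _
  have h3 : ρ f ∈ Ideal.span {q} := by
    have : Ideal.map ρ 𝔞 ≤ Ideal.span {q} := by
      rw [Ideal.map_sup, sup_le_iff]
      constructor
      · rw [Ideal.map_span, Ideal.span_le]
        rintro _ ⟨_, rfl, rfl⟩
        rw [hρι]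
        exact Ideal.mem_span_singleton_self _
      · rw [Ideal.map_span, Ideal.span_le]
        rintro _ ⟨_, ⟨t, rfl⟩, rfl⟩
        simp [ρ]
    exact this (Ideal.mem_map_of_mem ρ hf)
  have h4 : p = ρ (ι p - f) + ρ f := by rw [map_sub, hρι]; ring
  rw [h4]
  exact Submodule.add_mem_sup h2 h3

theorem exists_sub_aeval_mem_sup (e : σ ⊕ τ ≃ υ) (hx : ∀ s, eval w (x s) = 0)
    (hy : ∀ t, eval w (y t) = 0)
    (hJ : ∀ d : υ → K, (∀ s, dirDeriv w d (x s) = 0) → (∀ t, dirDeriv w d (y t) = 0) → d = 0)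
    (n : ℕ) (g : MvPolynomial υ K) :
    ∃ p : MvPolynomial σ K, g - aeval x p ∈
      vanishingIdeal K {w} ^ n ⊔ Ideal.span (Set.range y) := by
  let φ : υ → MvPolynomial υ K := fun j => Sum.elim x y (e.symm j)
  have hφ : ∀ j, eval w (φ j) = 0 := by
    intro j
    rcases h : e.symm j with s | t <;> simp [φ, h, hx, hy]
  have hφJ : ∀ d : υ → K, (∀ j, dirDeriv w d (φ j) = 0) → d = 0 := fun d hd =>
    hJ d (fun s => by simpa [φ] using hd (e (Sum.inl s)))
      (fun t => by simpa [φ] using hd (e (Sum.inr t)))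
  obtain ⟨f, hf⟩ := exists_sub_aeval_mem_vanishingIdeal_pow hφ hφJ n g
  refine ⟨aeval (fun j => Sum.elim X (fun _ => 0) (e.symm j)) f, ?_⟩
  have h1 : ∀ f : MvPolynomial υ K, aeval φ f -
      aeval x (aeval (fun j => Sum.elim X (fun _ => 0) (e.symm j)) f : MvPolynomial σ K) ∈
      Ideal.span (Set.range y) := by
    intro f
    rw [← Ideal.Quotient.mk_eq_mk_iff_sub_mem]
    have h2 : (Ideal.Quotient.mkₐ K (Ideal.span (Set.range y))).comp (aeval φ) =
        (Ideal.Quotient.mkₐ K (Ideal.span (Set.range y))).comp ((aeval x).comp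
          (aeval fun j => Sum.elim X (fun _ => 0) (e.symm j))) := by
      ext j
      rcases h : e.symm j with s | t
      · simp [φ, h]
      · simp [φ, h]
    exact DFunLike.congr_fun h2 f
  have h3 := Submodule.add_mem_sup hf (h1 f)
  rwa [sub_add_sub_cancel] at h3

variable [Finite σ]

/-- Let `x, y` be local coordinates at the point `w` of affine space. The complete local ring at `w`
of the subscheme `q(x) = 0, y = 0` is the quotient of the power series ring in the `x` by `q`. -/
theorem nonempty_adicCompletion_algEquiv (e : σ ⊕ τ ≃ υ) (hx : ∀ s, eval w (x s) = 0)
    (hy : ∀ t, eval w (y t) = 0)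
    (hJ : ∀ d : υ → K, (∀ s, dirDeriv w d (x s) = 0) → (∀ t, dirDeriv w d (y t) = 0) → d = 0)
    (q : MvPolynomial σ K) (I : Ideal (MvPolynomial υ K))
    (hI : I = Ideal.span {aeval x q} ⊔ Ideal.span (Set.range y)) :
    Nonempty (AdicCompletion (Ideal.map (Ideal.Quotient.mk I) (vanishingIdeal K {w}))
      (MvPolynomial υ K ⧸ I) ≃ₐ[K]
        MvPowerSeries σ K ⧸ Ideal.span {(q : MvPowerSeries σ K)}) := by
  let m := vanishingIdeal K {w}
  let m' := Ideal.map (Ideal.Quotient.mk I) m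
  let N : Ideal (MvPowerSeries σ K) := Ideal.span (Set.range MvPowerSeries.X)
  let g : (n : ℕ) → MvPolynomial σ K →ₐ[K] (MvPolynomial υ K ⧸ I) ⧸ m' ^ n := fun n =>
    (Ideal.Quotient.mkₐ K (m' ^ n)).comp ((Ideal.Quotient.mkₐ K I).comp (aeval x))
  have hg0 : ∀ n p, g n p = 0 ↔ aeval x p ∈ m ^ n ⊔ I := by
    intro n p
    change Ideal.Quotient.mk (m' ^ n) (Ideal.Quotient.mk I (aeval x p)) = 0 ↔ _
    rw [Ideal.Quotient.eq_zero_iff_mem, ← Ideal.map_pow, ← Ideal.mem_comap,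
      Ideal.comap_map_of_surjective' _ Ideal.Quotient.mk_surjective, Ideal.mk_ker]
  have hgn : ∀ n, ∀ p ∈ idealOfVars σ K ^ n, g n p = 0 := fun n p hp => (hg0 n p).mpr
    (Ideal.mem_sup_left (aeval_mem_idealOfVars_pow
      (fun s => mem_vanishingIdeal_singleton.mpr (hx s)) n hp))
  have hgX : ∀ n s, g n (X s) ∈ Ideal.map (Ideal.Quotient.mk (m' ^ n)) m' := by
    intro n s
    change Ideal.Quotient.mk (m' ^ n) (Ideal.Quotient.mk I (aeval x (X s))) ∈ _
    rw [aeval_X]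
    exact Ideal.mem_map_of_mem _ (Ideal.mem_map_of_mem _
      (mem_vanishingIdeal_singleton.mpr (hx s)))
  -- Truncate below degree n, then substitute `x`. The neglected terms are harmless because each `x
  -- s` vanishes at `w`.
  let χ : (n : ℕ) → MvPowerSeries σ K →ₐ[K] (MvPolynomial υ K ⧸ I) ⧸ m' ^ n := fun n =>
    (Ideal.Quotient.liftₐ (idealOfVars σ K ^ n) (g n) (hgn n)).comp
      ((MvPowerSeries.truncTotalAlgHom σ K n).restrictScalars K)
  have hχ : ∀ n f, χ n f = g n (f.truncTotal n) := fun n f => rfl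
  have hχcoe : ∀ n (p : MvPolynomial σ K), χ n p = g n p := by
    intro n p
    rw [hχ, ← sub_eq_zero, ← map_sub]
    refine hgn n _ ?_
    rw [mem_pow_idealOfVars_iff']
    intro d hd
    rw [coeff_sub, MvPowerSeries.coeff_truncTotal _ hd, coeff_coe, sub_self]
  clear_value χ
  refine AdicCompletion.nonempty_algEquiv_quotient N _ m' χ ?_ ?_ ?_
  · intro i j hij
    ext f
    simp only [AlgHom.comp_apply, hχ]
    have h1 : ∀ p, Ideal.Quotient.factorₐ K (Ideal.pow_le_pow_right hij) (g j p) = g i p :=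
      fun p => rfl
    rw [h1, ← sub_eq_zero, ← map_sub]
    exact hgn i _ (MvPowerSeries.truncTotal_sub_truncTotal_mem_pow_idealOfVars hij le_rfl f)
  · intro n z
    obtain ⟨z, rfl⟩ := Ideal.Quotient.mk_surjective z
    obtain ⟨z, rfl⟩ := Ideal.Quotient.mk_surjective z
    obtain ⟨p, hp⟩ := exists_sub_aeval_mem_sup e hx hy hJ n z
    refine ⟨p, ?_⟩
    rw [hχcoe]
    change Ideal.Quotient.mk (m' ^ n) (Ideal.Quotient.mk I (aeval x p)) = _
    rw [eq_comm, Ideal.Quotient.eq, ← map_sub, ← Ideal.map_pow, ← Ideal.mem_comap,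
      Ideal.comap_map_of_surjective' _ Ideal.Quotient.mk_surjective, Ideal.mk_ker]
    have hyI : Ideal.span (Set.range y) ≤ I := hI ▸ le_sup_right
    have hsup : m ^ n ⊔ Ideal.span (Set.range y) ≤ m ^ n ⊔ I := sup_le_sup_left hyI _
    exact hsup hp
  · intro n f
    constructor
    · intro h
      rw [hχ, hg0, hI] at h
      have h1 := mem_sup_of_aeval_mem e hx hy hJ q n h
      have h2 : f - (f.truncTotal n : MvPowerSeries σ K) ∈ N ^ n := by
        refine MvPowerSeries.mem_span_X_pow_of_truncTotal_eq_zero n _ ?_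
        ext d
        rw [MvPowerSeries.coeff_truncTotal_eq_ite]
        split_ifs with hd
        · simp [MvPowerSeries.coeff_truncTotal _ hd]
        · simp
      have h3 : Ideal.map (coeToMvPowerSeries.ringHom (σ := σ) (R := K))
          (idealOfVars σ K ^ n ⊔ Ideal.span {q}) ≤
          N ^ n ⊔ Ideal.span {(q : MvPowerSeries σ K)} := by
        rw [Ideal.map_sup, Ideal.map_pow]
        refine sup_le_sup (Ideal.pow_right_mono ?_ n) ?_
        · rw [Ideal.map_span, Ideal.span_le]
          rintro _ ⟨_, ⟨s, rfl⟩, rfl⟩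
          exact Ideal.subset_span ⟨s, by simp⟩
        · rw [Ideal.map_span, Set.image_singleton]
          exact le_rfl
      have h4 := h3 (Ideal.mem_map_of_mem _ h1)
      have h5 := add_mem (Ideal.mem_sup_left (T := Ideal.span {(q : MvPowerSeries σ K)}) h2) h4
      simpa using h5
    · intro h
      obtain ⟨u, hu, v, hv, rfl⟩ := Submodule.mem_sup.mp h
      obtain ⟨c, rfl⟩ := Ideal.mem_span_singleton'.mp hv
      have hq : χ n q = 0 := by
        rw [hχcoe, hg0]
        exact Ideal.mem_sup_right (hI ▸ Ideal.mem_sup_left (Ideal.mem_span_singleton_self _))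
      have hu' : χ n u = 0 := by
        refine Ideal.apply_eq_zero_of_mem_span_pow n (χ n) MvPowerSeries.X (fun s => ?_) hu
        rw [← coe_X, hχcoe]
        exact hgX n s
      rw [map_add, map_mul, hu', hq, mul_zero, add_zero]

end LocalCoordinates

end MvPolynomial

/-! ### The pencil of plane cubics -/

section Pencil

variable {R S : Type*} [CommRing R] [CommRing S]

/-- The first generator of the pencil of plane cubics. -/
def pencilF (a : Fin 3 → R) : R := (a 0 + a 1) * (a 2 ^ 2 - a 0 * a 1)

/-- The second generator of the pencil of plane cubics. -/
def pencilG (a : Fin 3 → R) : R := (a 0 + a 2) * (a 0 * a 2 - a 1 ^ 2)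

/-- The `k`-th reducible member of the pencil is `memberF k • pencilF + memberG k • pencilG`. -/
def memberF : Fin 6 → R := ![1, 0, 1, 1, 1, -2]

/-- The `k`-th reducible member of the pencil is `memberF k • pencilF + memberG k • pencilG`. -/
def memberG : Fin 6 → R := ![0, 1, -1, 1, -2, 1]

/-- Coefficients of a member of the pencil that is different from the `k`-th reducible one. -/
def otherF : Fin 6 → R := ![0, 1, 1, 1, 0, 1]

/-- Coefficients of a member of the pencil that is different from the `k`-th reducible one. -/
def otherG : Fin 6 → R := ![-1, 0, 0, 0, -1, 0]

/-- The linear factor of the `k`-th reducible member. -/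
def lineForm (k : Fin 6) (a : Fin 3 → R) : R :=
  ![a 0 + a 1, -(a 0 + a 2), -(a 1 + a 2), a 2 - a 1, a 1 - a 0, a 0 - a 2] k

/-- The quadratic factor of the `k`-th reducible member. -/
def conicForm (k : Fin 6) (a : Fin 3 → R) : R :=
  ![a 2 ^ 2 - a 0 * a 1, a 1 ^ 2 - a 0 * a 2, a 0 ^ 2 - a 1 * a 2,
    a 0 ^ 2 + 2 * a 0 * (a 1 + a 2) + a 1 * a 2, a 2 ^ 2 + 2 * a 2 * (a 0 + a 1) + a 0 * a 1,
    a 1 ^ 2 + 2 * a 1 * (a 0 + a 2) + a 0 * a 2] k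

/-- A parametrization of the line in the `k`-th reducible member. -/
def lineParam (k : Fin 6) (u w : R) : Fin 3 → R :=
  ![![u, -u, w], ![u, w, -u], ![w, u, -u], ![w, u, u], ![u, u, w], ![u, w, u]] k

/-- The index of the coordinate that is the first parameter of the line. -/
def lineFst : Fin 6 → Fin 3 := ![0, 0, 1, 1, 0, 0]

/-- The index of the coordinate that is the second parameter of the line. -/
def lineSnd : Fin 6 → Fin 3 := ![2, 1, 0, 0, 2, 1]

/-- The nodes of the `k`-th reducible member are the points of the line whose parameters satisfy
`w² + nodeTrace k * u * w + u² = 0`. -/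
def nodeTrace : Fin 6 → R := ![0, 0, 0, 4, 4, 4]

theorem map_pencilF (φ : R →+* S) (a : Fin 3 → R) : φ (pencilF a) = pencilF (φ ∘ a) := by
  simp [pencilF]

theorem map_pencilG (φ : R →+* S) (a : Fin 3 → R) : φ (pencilG a) = pencilG (φ ∘ a) := by
  simp [pencilG]

theorem map_lineForm (φ : R →+* S) (k : Fin 6) (a : Fin 3 → R) :
    φ (lineForm k a) = lineForm k (φ ∘ a) := by
  fin_cases k <;> simp [lineForm]

theorem map_conicForm (φ : R →+* S) (k : Fin 6) (a : Fin 3 → R) :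
    φ (conicForm k a) = conicForm k (φ ∘ a) := by
  fin_cases k <;> simp [conicForm, map_ofNat]

theorem member_eq_mul (k : Fin 6) (a : Fin 3 → R) :
    memberF k * pencilF a + memberG k * pencilG a = lineForm k a * conicForm k a := by
  fin_cases k <;> simp [memberF, memberG, pencilF, pencilG, lineForm, conicForm] <;> ring

theorem lineForm_lineParam (k : Fin 6) (u w : R) : lineForm k (lineParam k u w) = 0 := by
  fin_cases k <;> simp [lineForm, lineParam]

theorem conicForm_lineParam (k : Fin 6) (u w : R) :
    conicForm k (lineParam k u w) = w ^ 2 + nodeTrace k * u * w + u ^ 2 := by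
  fin_cases k <;> simp [conicForm, lineParam, nodeTrace] <;> ring

/-- The second member and the signs in `lineParam` are normalized so that this binary cubic does not
depend on k. Hence all nodes and all surfaces can be treated uniformly. -/
theorem other_lineParam (k : Fin 6) (u w : R) :
    otherF k * pencilF (lineParam k u w) + otherG k * pencilG (lineParam k u w) =
      u ^ 3 - u * w ^ 2 := by
  fin_cases k <;> simp [otherF, otherG, pencilF, pencilG, lineParam] <;> ring

theorem lineParam_lineFst (k : Fin 6) (u w : R) : lineParam k u w (lineFst k) = u := by
  fin_cases k <;> simp [lineParam, lineFst]

theorem lineParam_lineSnd (k : Fin 6) (u w : R) : lineParam k u w (lineSnd k) = w := by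
  fin_cases k <;> simp [lineParam, lineSnd]

theorem smul_lineParam (k : Fin 6) (c u w : R) :
    c • lineParam k u w = lineParam k (c * u) (c * w) := by
  funext i
  fin_cases k <;> fin_cases i <;> simp [lineParam]

theorem map_lineParam (φ : R →+* S) (k : Fin 6) (u w : R) :
    φ ∘ lineParam k u w = lineParam k (φ u) (φ w) := by
  funext i
  fin_cases k <;> fin_cases i <;> simp [lineParam]

/-- Needed over ℂ, over the dual numbers and over the coordinate rings of the surfaces. -/
theorem lineParam_of_lineForm_eq_zero (k : Fin 6) (a : Fin 3 → R) (h : lineForm k a = 0) :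
    a = lineParam k (a (lineFst k)) (a (lineSnd k)) := by
  funext i
  fin_cases k <;> fin_cases i <;> simp [lineForm, lineParam, lineFst, lineSnd] at h ⊢ <;>
    first | linear_combination h | linear_combination -h

end Pencil

/-! ### Singular members of the pencil -/

section SingularMembers

variable {K : Type*} [Field K] [CharZero K]

/-- The hypotheses are the partial derivatives of r x(z² - y²) + q y(x² - z²) + p z(y² - x²). Three
conics without a common zero generate all forms of degree 4 = 3 · (2 - 1) + 1, so a multiple of x⁴
lies in their ideal. The explicit coefficients, with r eliminated, show that the product of the six
linear factors suffices as multiplier. -/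
theorem discriminant_mul_pow_eq_zero {p q r x y z : K} (h : p + q + r = 0)
    (h₁ : r * (z ^ 2 - y ^ 2) + 2 * x * (q * y - p * z) = 0)
    (h₂ : q * (x ^ 2 - z ^ 2) + 2 * y * (p * z - r * x) = 0)
    (h₃ : p * (y ^ 2 - x ^ 2) + 2 * z * (r * x - q * y) = 0) :
    p * q * r * (p - q) * (q - r) * (r - p) * x ^ 4 = 0 := by
  obtain rfl : r = -p - q := by linear_combination h
  linear_combination
    ((25/12 * q ^ 5 + 43/12 * p * q ^ 4 + 31/12 * p ^ 2 * q ^ 3 + 7/12 * p ^ 3 * q ^ 2) * z ^ 2 +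
      (7/12 * p * q ^ 4 + 7/3 * p ^ 2 * q ^ 3 + 23/6 * p ^ 3 * q ^ 2 + 7/3 * p ^ 4 * q +
        1/3 * p ^ 5) * y ^ 2 +
      (-7/2 * q ^ 5 - 22/3 * p * q ^ 4 - 6 * p ^ 2 * q ^ 3 - 8/3 * p ^ 3 * q ^ 2 -
        1/3 * p ^ 4 * q) * x * y +
      (-7/6 * q ^ 5 - 5 * p * q ^ 4 - 26/3 * p ^ 2 * q ^ 3 - 6 * p ^ 3 * q ^ 2 -
        4/3 * p ^ 4 * q) * x * z +
      (-7/6 * q ^ 5 - 25/3 * p * q ^ 4 - 37/3 * p ^ 2 * q ^ 3 - 22/3 * p ^ 3 * q ^ 2 -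
        4/3 * p ^ 4 * q) * y * z +
      (-7/4 * q ^ 5 + 1/6 * p * q ^ 4 + 77/12 * p ^ 2 * q ^ 3 + 83/12 * p ^ 3 * q ^ 2 +
        2 * p ^ 4 * q) * x ^ 2) * h₁ +
    ((-25/12 * q ^ 5 - 17/3 * p * q ^ 4 - 37/6 * p ^ 2 * q ^ 3 - 19/6 * p ^ 3 * q ^ 2 -
        7/12 * p ^ 4 * q) * z ^ 2 +
      (q ^ 5 + 7/2 * p * q ^ 4 + 14/3 * p ^ 2 * q ^ 3 + 5/2 * p ^ 3 * q ^ 2 + p ^ 4 * q +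
        1/6 * p ^ 5) * y * z +
      (7/4 * q ^ 5 + 19/6 * p * q ^ 4 + 7/6 * p ^ 2 * q ^ 3 - 2/3 * p ^ 3 * q ^ 2 -
        1/6 * p ^ 4 * q) * y ^ 2 +
      (7/2 * q ^ 5 + 5/2 * p * q ^ 4 - 5/2 * p ^ 2 * q ^ 3 - 7/2 * p ^ 3 * q ^ 2 -
        7/6 * p ^ 4 * q - 1/6 * p ^ 5) * x * y +
      (q ^ 5) * x * z +
      (-3/2 * p * q ^ 4 - 11/3 * p ^ 2 * q ^ 3 - 3/2 * p ^ 3 * q ^ 2 + 1/12 * p ^ 4 * q) * x ^ 2) * h₂ +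
    ((1/12 * q ^ 5 + 11/12 * p * q ^ 4 + 7/3 * p ^ 2 * q ^ 3 + 29/12 * p ^ 3 * q ^ 2 +
        2/3 * p ^ 4 * q) * z ^ 2 +
      (1/6 * q ^ 5 + 2 * p * q ^ 4 + 5 * p ^ 2 * q ^ 3 + 14/3 * p ^ 3 * q ^ 2 +
        p ^ 4 * q) * y * z +
      (-1/6 * q ^ 5) * x * z +
      (-7/12 * q ^ 5 - 35/12 * p * q ^ 4 - 37/6 * p ^ 2 * q ^ 3 - 37/6 * p ^ 3 * q ^ 2 -
        8/3 * p ^ 4 * q - 1/3 * p ^ 5) * y ^ 2 +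
      (-1/6 * q ^ 5) * x * y +
      (1/2 * q ^ 5 + 4/3 * p * q ^ 4 - 3/2 * p ^ 2 * q ^ 3 - 59/12 * p ^ 3 * q ^ 2 -
        2 * p ^ 4 * q) * x ^ 2) * h₃

/-- The members of the pencil with a singular point are those with vanishing discriminant. -/
theorem discriminant_eq_zero {p q r : K} {a : Fin 3 → K} (ha : a ≠ 0) (h : p + q + r = 0)
    (h₁ : r * (a 2 ^ 2 - a 1 ^ 2) + 2 * a 0 * (q * a 1 - p * a 2) = 0)
    (h₂ : q * (a 0 ^ 2 - a 2 ^ 2) + 2 * a 1 * (p * a 2 - r * a 0) = 0)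
    (h₃ : p * (a 1 ^ 2 - a 0 ^ 2) + 2 * a 2 * (r * a 0 - q * a 1) = 0) :
    p * q * r * (p - q) * (q - r) * (r - p) = 0 := by
  by_contra hD
  have e₀ := discriminant_mul_pow_eq_zero h h₁ h₂ h₃
  -- The system is invariant under simultaneous cyclic shifts of the coordinates and the parameters,
  -- so the same identity controls the other two coordinates.
  have e₁ := discriminant_mul_pow_eq_zero (x := a 1) (y := a 2) (z := a 0) (p := r) (q := p)
    (r := q) (by linear_combination h) (by linear_combination h₂) (by linear_combination h₃)
    (by linear_combination h₁)
  have e₂ := discriminant_mul_pow_eq_zero (x := a 2) (y := a 0) (z := a 1) (p := q) (q := r)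
    (r := p) (by linear_combination h) (by linear_combination h₃) (by linear_combination h₁)
    (by linear_combination h₂)
  have e : ∀ t : K, p * q * r * (p - q) * (q - r) * (r - p) * t ^ 4 = 0 → t = 0 := fun t ht =>
    pow_eq_zero_iff (by norm_num) |>.mp ((mul_eq_zero.mp ht).resolve_left hD)
  refine ha (funext (Fin.forall_fin_succ.mpr ⟨e _ e₀, Fin.forall_fin_two.mpr ⟨?_, ?_⟩⟩))
  · exact e (a 1) (by linear_combination e₁)
  · exact e (a 2) (by linear_combination e₂)

/-- The hypotheses are the partial derivatives, the last one halved, of (x + y)(z² - xy). Off the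
line they force z = 0 and x = y, hence 3x² = 0. -/
theorem node_of_line_mul_conic {x y z : K} (h₁ : z ^ 2 - 2 * x * y - y ^ 2 = 0)
    (h₂ : z ^ 2 - 2 * x * y - x ^ 2 = 0) (h₃ : z * (x + y) = 0) :
    x + y = 0 ∧ z ^ 2 - x * y = 0 := by
  have h : x + y = 0 := by
    by_contra hxy
    have hz : z = 0 := (mul_eq_zero.mp h₃).resolve_right hxy
    have hx : x = y := by
      have : (x + y) * (x - y) = 0 := by linear_combination h₁ - h₂
      linear_combination (mul_eq_zero.mp this).resolve_left hxy
    subst hz hx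
    have : x ^ 2 = 0 := by linear_combination -(1 / 3) * h₁
    have hx0 : x = 0 := pow_eq_zero_iff (by norm_num) |>.mp this
    exact hxy (by rw [hx0, add_zero])
  exact ⟨h, by linear_combination h₁ + y * h⟩

/-- The hypotheses are the partial derivatives, the first one halved, of (z - y)(x² + 2x(y + z) +
yz). Off the line they force x + y + z = 4x + y + z = 0, so x = 0 and y = -z, and then z = 0. -/
theorem node_of_difference_line_mul_conic {x y z : K} (h₁ : (z - y) * (x + y + z) = 0)
    (h₂ : -(x ^ 2 + 2 * x * (y + z) + y * z) + (z - y) * (2 * x + z) = 0)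
    (h₃ : x ^ 2 + 2 * x * (y + z) + y * z + (z - y) * (2 * x + y) = 0) :
    z - y = 0 ∧ x ^ 2 + 2 * x * (y + z) + y * z = 0 := by
  have h : z - y = 0 := by
    by_contra hzy
    have e₁ : x + y + z = 0 := (mul_eq_zero.mp h₁).resolve_left hzy
    have e₂ : 4 * x + y + z = 0 := by
      have : (z - y) * (4 * x + y + z) = 0 := by linear_combination h₂ + h₃
      exact (mul_eq_zero.mp this).resolve_left hzy
    have hx : x = 0 := by linear_combination (1 / 3) * (e₂ - e₁)
    subst hx
    have hy : y = -z := by linear_combination e₁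
    subst hy
    have : z ^ 2 = 0 := by linear_combination -(1 / 3) * h₃
    have hz : z = 0 := pow_eq_zero_iff (by norm_num) |>.mp this
    exact hzy (by rw [hz]; ring)
  exact ⟨h, by linear_combination h₃ - (2 * x + y) * h⟩

/-- A singular point of the `k`-th reducible member of the pencil is a point of intersection of the
line and the conic. -/
theorem line_conic_eq_zero_of_gradient (k : Fin 6) {a : Fin 3 → K}
    (h₁ : memberF k * (a 2 ^ 2 - 2 * a 0 * a 1 - a 1 ^ 2) +
      memberG k * (2 * a 0 * a 2 + a 2 ^ 2 - a 1 ^ 2) = 0)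
    (h₂ : memberF k * (a 2 ^ 2 - a 0 ^ 2 - 2 * a 0 * a 1) -
      memberG k * (2 * a 1 * (a 0 + a 2)) = 0)
    (h₃ : memberF k * (2 * a 2 * (a 0 + a 1)) +
      memberG k * (a 0 ^ 2 + 2 * a 0 * a 2 - a 1 ^ 2) = 0) :
    lineForm k a = 0 ∧ conicForm k a = 0 := by
  -- Up to a permutation of the coordinates and a sign, members 0, 1, 2 are the first model and
  -- members 3, 4, 5 the second.
  fin_cases k <;> simp only [memberF, memberG, lineForm, conicForm, Fin.zero_eta, Fin.mk_one,
    Fin.reduceFinMk, Matrix.cons_val] at h₁ h₂ h₃ ⊢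
  · exact node_of_line_mul_conic (by linear_combination h₁) (by linear_combination h₂)
      (by linear_combination (1 / 2) * h₃)
  · have h := node_of_line_mul_conic (x := a 0) (y := a 2) (z := a 1)
      (by linear_combination -h₁) (by linear_combination -h₃)
      (by linear_combination -(1 / 2) * h₂)
    exact ⟨by linear_combination -h.1, h.2⟩
  · have h := node_of_line_mul_conic (x := a 1) (y := a 2) (z := a 0)
      (by linear_combination -h₂) (by linear_combination -h₃)
      (by linear_combination -(1 / 2) * h₁)
    exact ⟨by linear_combination -h.1, h.2⟩
  · exact node_of_difference_line_mul_conic (by linear_combination (1 / 2) * h₁)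
      (by linear_combination h₂) (by linear_combination h₃)
  · have h := node_of_difference_line_mul_conic (x := a 2) (y := a 0) (z := a 1)
      (by linear_combination (1 / 2) * h₃) (by linear_combination h₁) (by linear_combination h₂)
    exact h
  · have h := node_of_difference_line_mul_conic (x := a 1) (y := a 2) (z := a 0)
      (by linear_combination (1 / 2) * h₂) (by linear_combination h₃) (by linear_combination h₁)
    exact ⟨h.1, by linear_combination h.2⟩

end SingularMembers

/-! ### Zero sets and Jacobian ranks of homogeneous ideals -/

namespace ProjVar

variable {n : ℕ}

theorem eval_smul_of_isHomogeneous {d : ℕ} {F : CoordRing n} (hF : F.IsHomogeneous d) (c : ℂ)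
    (v : Fin (n + 1) → ℂ) : eval (c • v) F = c ^ d * eval v F :=
  congrFun (evalTuple_smul (G := fun _ => F) (fun _ => hF) c v) 0

theorem mem_zeroSet_span_iff {s : Set (CoordRing n)} (hs : ∀ F ∈ s, ∃ d, F.IsHomogeneous d)
    (p : ProjSpace n) : p ∈ zeroSet (Ideal.span s) ↔ ∀ F ∈ s, eval p.rep F = 0 := by
  constructor
  · intro h F hF
    refine h F (Ideal.subset_span hF) _ ?_
    rw [Projectivization.submodule_eq]
    exact Submodule.mem_span_singleton_self _
  · intro h F hF v hv
    rw [Projectivization.submodule_eq, Submodule.mem_span_singleton] at hv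
    obtain ⟨c, rfl⟩ := hv
    have h1 : Ideal.span s ≤ RingHom.ker (eval (c • p.rep)) := by
      rw [Ideal.span_le]
      intro G hG
      obtain ⟨d, hd⟩ := hs G hG
      simp [eval_smul_of_isHomogeneous hd, h G hG]
    exact h1 hF

theorem mk_mem_zeroSet_span_iff {s : Set (CoordRing n)} (hs : ∀ F ∈ s, ∃ d, F.IsHomogeneous d)
    (v : Fin (n + 1) → ℂ) (hv : v ≠ 0) :
    Projectivization.mk ℂ v hv ∈ zeroSet (Ideal.span s) ↔ ∀ F ∈ s, eval v F = 0 := by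
  rw [mem_zeroSet_span_iff hs]
  obtain ⟨c, hc⟩ := Projectivization.exists_smul_eq_mk_rep ℂ v hv
  refine forall₂_congr fun F hF => ?_
  obtain ⟨d, hd⟩ := hs F hF
  rw [← hc, Units.smul_def, eval_smul_of_isHomogeneous hd]
  simp

/-- The gradient of a polynomial. -/
noncomputable def gradientAt (v : Fin (n + 1) → ℂ) (F : CoordRing n) : Fin (n + 1) → ℂ :=
  fun j => eval v (pderiv j F)

/-- At a common zero the Leibniz rule gives ∇(aF) = a(p)∇F, so the gradients of the generators
already span. -/
theorem jacobianRank_span_range {ι : Type*} [Fintype ι] (g : ι → CoordRing n) (p : ProjSpace n)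
    (hp : p ∈ zeroSet (Ideal.span (Set.range g))) :
    jacobianRank (Ideal.span (Set.range g)) p =
      Module.finrank ℂ (Submodule.span ℂ (Set.range fun i => gradientAt p.rep (g i))) := by
  have hrep : ∀ F ∈ Ideal.span (Set.range g), eval p.rep F = 0 := fun F hF => by
    refine hp F hF _ ?_
    rw [Projectivization.submodule_eq]
    exact Submodule.mem_span_singleton_self _
  have hspan : Submodule.span ℂ {h : Fin (n + 1) → ℂ | ∃ F ∈ Ideal.span (Set.range g),
      h = fun j => eval p.rep (pderiv j F)} =
      Submodule.span ℂ (Set.range fun i => gradientAt p.rep (g i)) := by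
    refine le_antisymm (Submodule.span_le.mpr ?_) (Submodule.span_mono ?_)
    · rintro _ ⟨F, hF, rfl⟩
      rw [SetLike.mem_coe]
      change gradientAt p.rep F ∈ _
      induction hF using Submodule.span_induction with
      | mem F hF =>
        obtain ⟨i, rfl⟩ := hF
        exact Submodule.subset_span ⟨i, rfl⟩
      | zero =>
        have : gradientAt p.rep (0 : CoordRing n) = 0 := by funext j; simp [gradientAt]
        rw [this]
        exact zero_mem _
      | add F G _ _ hF hG =>
        have : gradientAt p.rep (F + G) = gradientAt p.rep F + gradientAt p.rep G := by
          funext j; simp [gradientAt]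
        rw [this]
        exact add_mem hF hG
      | smul a F hF ih =>
        have : gradientAt p.rep (a • F) = eval p.rep a • gradientAt p.rep F := by
          funext j; simp [gradientAt, hrep F hF]
        rw [this]
        exact Submodule.smul_mem _ _ ih
    · rintro _ ⟨i, rfl⟩
      exact ⟨g i, Ideal.subset_span ⟨i, rfl⟩, rfl⟩
  rw [jacobianRank, hspan]

theorem isSmoothPoint_span_range_iff {c : ℕ} (g : Fin c → CoordRing n) (p : ProjSpace n)
    (hp : p ∈ zeroSet (Ideal.span (Set.range g))) :
    IsSmoothPoint (Ideal.span (Set.range g)) c p ↔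
      LinearIndependent ℂ fun i => gradientAt p.rep (g i) := by
  rw [IsSmoothPoint, jacobianRank_span_range g p hp, linearIndependent_iff_card_eq_finrank_span,
    Fintype.card_fin, eq_comm, Set.finrank]

end ProjVar

open ProjVar

/-! ### The two cubics -/

section Cubics

variable {R S : Type*}

/-- The coordinates `v₁, v₂, v₃`. -/
def partA (v : Fin 6 → R) : Fin 3 → R := ![v 1, v 2, v 3]

/-- The coordinates `v₀, v₅, v₄`. -/
def partB (v : Fin 6 → R) : Fin 3 → R := ![v 0, v 5, v 4]

/-- The vector with given parts. -/
def joinParts (a b : Fin 3 → R) : Fin 6 → R := ![b 0, a 0, a 1, a 2, b 2, b 1]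

@[simp] theorem partA_joinParts (a b : Fin 3 → R) : partA (joinParts a b) = a := by
  funext i; fin_cases i <;> rfl

@[simp] theorem partB_joinParts (a b : Fin 3 → R) : partB (joinParts a b) = b := by
  funext i; fin_cases i <;> rfl

theorem joinParts_partA_partB (v : Fin 6 → R) : joinParts (partA v) (partB v) = v := by
  funext i; fin_cases i <;> rfl

theorem comp_partA (φ : R → S) (v : Fin 6 → R) : φ ∘ partA v = partA (φ ∘ v) := by
  funext i; fin_cases i <;> rfl

theorem comp_partB (φ : R → S) (v : Fin 6 → R) : φ ∘ partB v = partB (φ ∘ v) := by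
  funext i; fin_cases i <;> rfl

theorem smul_joinParts [Mul R] (c : R) (a b : Fin 3 → R) :
    c • joinParts a b = joinParts (c • a) (c • b) := by
  funext i; fin_cases i <;> rfl

theorem eval_comp_X (v : Fin 6 → ℂ) : (eval v) ∘ (X : Fin 6 → CoordRing 5) = v := by
  funext j; simp

/-- With `A2'_eq`, the separation of variables on which the whole argument rests. -/
theorem A1'_eq : A1' = pencilF (partA X) + pencilF (partB X) := by
  simp only [A1', F1, F2, F6, F7, pencilF, partA, partB, Matrix.cons_val]
  ring

theorem A2'_eq : A2' = pencilG (partA X) + pencilG (partB X) := by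
  simp only [A2', F2, F3, F5, F6, pencilG, partA, partB, Matrix.cons_val]
  ring

theorem eval_A1' (v : Fin 6 → ℂ) : eval v A1' = pencilF (partA v) + pencilF (partB v) := by
  rw [A1'_eq, map_add, map_pencilF, map_pencilF, comp_partA, comp_partB, eval_comp_X]

theorem eval_A2' (v : Fin 6 → ℂ) : eval v A2' = pencilG (partA v) + pencilG (partB v) := by
  rw [A2'_eq, map_add, map_pencilG, map_pencilG, comp_partA, comp_partB, eval_comp_X]

theorem isHomogeneous_of_cubic_terms (i j k l m p : Fin 6) :
    ((X i * X j * X k - X l * X m * X p : CoordRing 5)).IsHomogeneous 3 :=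
  ((((isHomogeneous_X ℂ i).mul (isHomogeneous_X ℂ j)).mul (isHomogeneous_X ℂ k))).sub
    ((((isHomogeneous_X ℂ l).mul (isHomogeneous_X ℂ m)).mul (isHomogeneous_X ℂ p)))

theorem isHomogeneous_A1' : A1'.IsHomogeneous 3 := by
  have : A1' = (X 2 * X 3 * X 3 - X 0 * X 0 * X 5) + (X 1 * X 3 * X 3 - X 0 * X 5 * X 5) -
      (X 1 * X 2 * X 2 - X 0 * X 4 * X 4) - (X 1 * X 1 * X 2 - X 4 * X 4 * X 5) := by
    simp only [A1', F1, F2, F6, F7]; ring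
  rw [this]
  exact (((isHomogeneous_of_cubic_terms ..).add (isHomogeneous_of_cubic_terms ..)).sub
    (isHomogeneous_of_cubic_terms ..)).sub (isHomogeneous_of_cubic_terms ..)

theorem isHomogeneous_A2' : A2'.IsHomogeneous 3 := by
  have : A2' = (X 1 * X 3 * X 3 - X 0 * X 5 * X 5) - (X 2 * X 2 * X 3 - X 0 * X 0 * X 4) +
      (X 1 * X 1 * X 3 - X 4 * X 5 * X 5) - (X 1 * X 2 * X 2 - X 0 * X 4 * X 4) := by
    simp only [A2', F2, F3, F5, F6]; ring
  rw [this]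
  exact (((isHomogeneous_of_cubic_terms ..).sub (isHomogeneous_of_cubic_terms ..)).add
    (isHomogeneous_of_cubic_terms ..)).sub (isHomogeneous_of_cubic_terms ..)

theorem idealY'_eq_span_range : idealY' = Ideal.span (Set.range ![A1', A2']) := by
  rw [idealY', Matrix.range_cons, Matrix.range_cons, Matrix.range_empty, Set.union_empty]
  rfl

theorem isHomogeneous_generator :
    ∀ F ∈ ({A1', A2'} : Set (CoordRing 5)), ∃ d, F.IsHomogeneous d := by
  rintro F (rfl | rfl)
  exacts [⟨3, isHomogeneous_A1'⟩, ⟨3, isHomogeneous_A2'⟩]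

theorem mem_Y'_iff (p : ProjSpace 5) :
    p ∈ Y' ↔ eval p.rep A1' = 0 ∧ eval p.rep A2' = 0 := by
  rw [Y', idealY', mem_zeroSet_span_iff isHomogeneous_generator]
  simp

theorem mk_mem_Y'_iff (v : Fin 6 → ℂ) (hv : v ≠ 0) :
    Projectivization.mk ℂ v hv ∈ Y' ↔ eval v A1' = 0 ∧ eval v A2' = 0 := by
  rw [Y', idealY', mk_mem_zeroSet_span_iff isHomogeneous_generator]
  simp

/-- The vanishing of the gradient of `l • pencilF + m • pencilG` at `a`. -/
def IsCritical (l m : ℂ) (a : Fin 3 → ℂ) : Prop :=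
  l * (a 2 ^ 2 - 2 * a 0 * a 1 - a 1 ^ 2) + m * (2 * a 0 * a 2 + a 2 ^ 2 - a 1 ^ 2) = 0 ∧
  l * (a 2 ^ 2 - a 0 ^ 2 - 2 * a 0 * a 1) - m * (2 * a 1 * (a 0 + a 2)) = 0 ∧
  l * (2 * a 2 * (a 0 + a 1)) + m * (a 0 ^ 2 + 2 * a 0 * a 2 - a 1 ^ 2) = 0

/-- Each variable occurs in only one of the two parts, so the six partial derivatives are those of
one plane cubic, taken at both parts. -/
theorem gradient_combination_eq_zero_iff (l m : ℂ) (v : Fin 6 → ℂ) :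
    l • gradientAt v A1' + m • gradientAt v A2' = 0 ↔
      IsCritical l m (partA v) ∧ IsCritical l m (partB v) := by
  have h0 : ∀ c : Fin 6 → ℂ, c = 0 ↔ c 0 = 0 ∧ c 1 = 0 ∧ c 2 = 0 ∧ c 3 = 0 ∧ c 4 = 0 ∧ c 5 = 0 := by
    intro c
    constructor
    · rintro rfl; simp
    · rintro ⟨h0, h1, h2, h3, h4, h5⟩
      funext i; fin_cases i <;> assumption
  rw [h0]
  simp only [gradientAt, A1', A2', F1, F2, F3, F5, F6, F7, Pi.add_apply, Pi.smul_apply, smul_eq_mul,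
    IsCritical, partA, partB, Matrix.cons_val, map_add, map_sub, Derivation.leibniz,
    Derivation.leibniz_pow, pderiv_X, Pi.single_apply]
  simp
  constructor
  · rintro ⟨h0, h1, h2, h3, h4, h5⟩
    refine ⟨⟨?_, ?_, ?_⟩, ?_, ?_, ?_⟩
    · linear_combination h1
    · linear_combination h2
    · linear_combination h3
    · linear_combination h0
    · linear_combination h5
    · linear_combination h4
  · rintro ⟨⟨h1, h2, h3⟩, h0, h5, h4⟩
    refine ⟨?_, ?_, ?_, ?_, ?_, ?_⟩
    · linear_combination h0
    · linear_combination h1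
    · linear_combination h2
    · linear_combination h3
    · linear_combination h4
    · linear_combination h5

/-- The singular points of `Y'`. -/
theorem mem_singularLocus_iff (p : ProjSpace 5) :
    p ∈ singularLocus idealY' 2 ↔ p ∈ Y' ∧ ∃ l m : ℂ, (l ≠ 0 ∨ m ≠ 0) ∧
      IsCritical l m (partA p.rep) ∧ IsCritical l m (partB p.rep) := by
  unfold singularLocus
  rw [Set.mem_ofPred_eq]
  refine and_congr_right fun hp => ?_
  rw [idealY'_eq_span_range] at hp ⊢
  rw [isSmoothPoint_span_range_iff _ p hp]
  have h1 : (fun i => gradientAt p.rep (![A1', A2'] i)) =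
      ![gradientAt p.rep A1', gradientAt p.rep A2'] := by
    funext i; fin_cases i <;> rfl
  rw [h1, LinearIndependent.pair_iff]
  simp only [gradient_combination_eq_zero_iff]
  push Not
  refine exists₂_congr fun l m => ?_
  tauto

end Cubics

/-! ### The nodes of the reducible members of the pencil -/

section Nodes

theorem nodeTrace_eq (k : Fin 6) : (nodeTrace k : ℂ) = 0 ∨ (nodeTrace k : ℂ) = 4 := by
  fin_cases k <;> simp [nodeTrace]

/-- Half of the difference of the two slopes of the nodes of the `k`-th reducible member. -/
noncomputable def nodeRadius : Fin 6 → ℂ :=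
  ![Complex.I, Complex.I, Complex.I, (√3 : ℝ), (√3 : ℝ), (√3 : ℝ)]

theorem four_mul_nodeRadius_sq (k : Fin 6) : 4 * nodeRadius k ^ 2 = nodeTrace k ^ 2 - 4 := by
  have h3 : ((√3 : ℝ) : ℂ) ^ 2 = 3 := by
    rw [← Complex.ofReal_pow, Real.sq_sqrt (by norm_num)]; norm_num
  fin_cases k <;> simp [nodeRadius, nodeTrace, h3] <;> norm_num

theorem nodeTrace_sq_ne (k : Fin 6) : (nodeTrace k : ℂ) ^ 2 - 4 ≠ 0 := by
  rcases nodeTrace_eq k with h | h <;> rw [h] <;> norm_num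

theorem nodeRadius_ne_zero (k : Fin 6) : nodeRadius k ≠ 0 := by
  intro h
  have := four_mul_nodeRadius_sq k
  rw [h] at this
  exact nodeTrace_sq_ne k (by rw [← this]; ring)

/-- The quotients of the parameters of the two nodes of the `k`-th reducible member. -/
noncomputable def nodeSlope (k : Fin 6) (ε : Bool) : ℂ :=
  -nodeTrace k / 2 + (if ε then nodeRadius k else -nodeRadius k)

theorem nodeSlope_root (k : Fin 6) (ε : Bool) :
    nodeSlope k ε ^ 2 + nodeTrace k * nodeSlope k ε + 1 = 0 := by
  have := four_mul_nodeRadius_sq k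
  cases ε <;> simp only [nodeSlope, Bool.false_eq_true, if_true, if_false] <;>
    linear_combination (1 / 4) * this

theorem nodeSlope_injective (k : Fin 6) : Function.Injective (nodeSlope k) := by
  have h : nodeSlope k true ≠ nodeSlope k false := by
    intro h
    simp only [nodeSlope, Bool.false_eq_true, if_true, if_false] at h
    exact nodeRadius_ne_zero k (by linear_combination (1 / 2) * h)
  intro ε ε' hε
  cases ε <;> cases ε' <;> first | rfl | exact absurd hε h | exact absurd hε.symm h

theorem exists_nodeSlope_eq (k : Fin 6) {x : ℂ} (hx : x ^ 2 + nodeTrace k * x + 1 = 0) :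
    ∃ ε, x = nodeSlope k ε := by
  have h := four_mul_nodeRadius_sq k
  have h1 : (x + nodeTrace k / 2 - nodeRadius k) * (x + nodeTrace k / 2 + nodeRadius k) = 0 := by
    linear_combination hx - (1 / 4) * h
  rcases mul_eq_zero.mp h1 with h2 | h2
  · exact ⟨true, by simp only [nodeSlope, if_true]; linear_combination h2⟩
  · exact ⟨false, by
      simp only [nodeSlope, Bool.false_eq_true, if_false]; linear_combination h2⟩

/-- 1 - ρ² is the value of the second member at the node, so this says that the node is not a base
point of the pencil. If ρ² = 1, the quadratic equation gives Tρ = -2 and T² = 4, but the trace T is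
0 or 4. -/
theorem one_sub_nodeSlope_sq_ne_zero (k : Fin 6) (ε : Bool) : 1 - nodeSlope k ε ^ 2 ≠ 0 := by
  intro h
  have h1 := nodeSlope_root k ε
  refine nodeTrace_sq_ne k ?_
  linear_combination (nodeTrace k * nodeSlope k ε - 2) * h1 +
    (nodeTrace k ^ 2 + nodeTrace k * nodeSlope k ε - 2) * h

/-- The slope is a simple root since (2ρ + T)² = T² - 4. Geometrically the line is transversal to
the conic, which makes the double point ordinary. -/
theorem two_mul_nodeSlope_add_ne_zero (k : Fin 6) (ε : Bool) :
    2 * nodeSlope k ε + nodeTrace k ≠ 0 := by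
  intro h
  refine nodeTrace_sq_ne k ?_
  linear_combination (2 * nodeSlope k ε + nodeTrace k) * h - 4 * nodeSlope_root k ε

/-- The nodes of the `k`-th reducible member of the pencil. -/
noncomputable def node (k : Fin 6) (ε : Bool) : Fin 3 → ℂ := lineParam k 1 (nodeSlope k ε)

theorem lineForm_smul_node (k : Fin 6) (ε : Bool) (c : ℂ) : lineForm k (c • node k ε) = 0 := by
  rw [node, smul_lineParam, lineForm_lineParam]

theorem conicForm_smul_node (k : Fin 6) (ε : Bool) (c : ℂ) : conicForm k (c • node k ε) = 0 := by
  rw [node, smul_lineParam, conicForm_lineParam]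
  linear_combination c ^ 2 * nodeSlope_root k ε

theorem member_smul_node (k : Fin 6) (ε : Bool) (c : ℂ) :
    memberF k * pencilF (c • node k ε) + memberG k * pencilG (c • node k ε) = 0 := by
  rw [member_eq_mul, lineForm_smul_node, zero_mul]

theorem other_smul_node (k : Fin 6) (ε : Bool) (c : ℂ) :
    otherF k * pencilF (c • node k ε) + otherG k * pencilG (c • node k ε) =
      c ^ 3 * (1 - nodeSlope k ε ^ 2) := by
  rw [node, smul_lineParam, other_lineParam]
  ring

theorem node_lineFst (k : Fin 6) (ε : Bool) : node k ε (lineFst k) = 1 := lineParam_lineFst ..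

theorem node_ne_zero (k : Fin 6) (ε : Bool) : node k ε ≠ 0 := by
  intro h
  have := node_lineFst k ε
  rw [h] at this
  simp at this

theorem isCritical_smul_node (k : Fin 6) (ε : Bool) (c : ℂ) :
    IsCritical (memberF k) (memberG k) (c • node k ε) := by
  have h := nodeSlope_root k ε
  rw [node, smul_lineParam]
  generalize nodeSlope k ε = ρ at h
  fin_cases k <;> simp only [memberF, memberG, nodeTrace, lineParam, IsCritical, Fin.zero_eta,
    Fin.mk_one, Fin.reduceFinMk, Matrix.cons_val] at h ⊢ <;> refine ⟨?_, ?_, ?_⟩ <;>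
    first
    | ring1
    | linear_combination c ^ 2 * h
    | linear_combination -c ^ 2 * h

/-- The determinant of the change of generators of the pencil is `1` or `-1`. -/
theorem member_det_sq {R : Type*} [CommRing R] (k : Fin 6) :
    (memberF k * otherG k - memberG k * otherF k : R) ^ 2 = 1 := by
  fin_cases k <;> simp [memberF, memberG, otherF, otherG]

/-- Cramer's rule; the determinant is its own inverse by `member_det_sq`. -/
theorem eq_zero_of_member_other {R : Type*} [CommRing R] (k : Fin 6) {s t : R}
    (h₁ : memberF k * s + memberG k * t = 0) (h₂ : otherF k * s + otherG k * t = 0) :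
    s = 0 ∧ t = 0 := by
  have hd := member_det_sq (R := R) k
  constructor
  · linear_combination -s * hd + (memberF k * otherG k - memberG k * otherF k) *
      (otherG k * h₁ - memberG k * h₂)
  · linear_combination -t * hd + (memberF k * otherG k - memberG k * otherF k) *
      (memberF k * h₂ - otherF k * h₁)

theorem member_eq_of_proportional {k k' : Fin 6}
    (h : (memberF k * memberG k' : ℂ) = memberF k' * memberG k) : k = k' := by
  fin_cases k <;> fin_cases k' <;> first | rfl | (norm_num [memberF, memberG] at h)

/-- A critical point of a member of the pencil is one of the twelve nodes. -/
theorem exists_node_of_isCritical {l m : ℂ} (hlm : l ≠ 0 ∨ m ≠ 0) {a : Fin 3 → ℂ} (ha : a ≠ 0)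
    (h : IsCritical l m a) :
    ∃ (k : Fin 6) (ε : Bool) (c s : ℂ), c ≠ 0 ∧ s ≠ 0 ∧ a = c • node k ε ∧ l = s * memberF k ∧ m = s * memberG k := by
  obtain ⟨h₁, h₂, h₃⟩ := h
  have hk : ∃ (k : Fin 6) (s : ℂ), s ≠ 0 ∧ l = s * memberF k ∧ m = s * memberG k := by
    -- In these parameters the gradient equations take their symmetric form. The six factors of the
    -- discriminant correspond, in this order, to k = 0, …, 5.
    have hD := discriminant_eq_zero (p := -m) (q := -l) (r := l + m) ha (by ring)
      (by linear_combination h₁) (by linear_combination h₂) (by linear_combination h₃)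
    simp only [mul_eq_zero] at hD
    rcases hD with ((((hD | hD) | hD) | hD) | hD) | hD
    · have hm : m = 0 := by linear_combination -hD
      exact ⟨0, l, hlm.resolve_right (not_not.mpr hm), by simp [memberF], by simp [memberG, hm]⟩
    · have hl : l = 0 := by linear_combination -hD
      exact ⟨1, m, hlm.resolve_left (not_not.mpr hl), by simp [memberF, hl], by simp [memberG]⟩
    · obtain rfl : m = -l := by linear_combination hD
      exact ⟨2, l, by simpa using hlm, by simp [memberF], by simp [memberG]⟩
    · obtain rfl : m = l := by linear_combination -hD
      exact ⟨3, m, by simpa using hlm, by simp [memberF], by simp [memberG]⟩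
    · obtain rfl : m = -2 * l := by linear_combination -hD
      exact ⟨4, l, by simpa using hlm, by simp [memberF], by simp [memberG]; ring⟩
    · obtain rfl : l = -2 * m := by linear_combination hD
      exact ⟨5, m, by simpa using hlm, by simp [memberF]; ring, by simp [memberG]⟩
  obtain ⟨k, s, hs, rfl, rfl⟩ := hk
  have hline := line_conic_eq_zero_of_gradient k (a := a)
    (mul_left_cancel₀ hs (by linear_combination h₁))
    (mul_left_cancel₀ hs (by linear_combination h₂))
    (mul_left_cancel₀ hs (by linear_combination h₃))
  have hpar := lineParam_of_lineForm_eq_zero k a hline.1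
  generalize a (lineFst k) = u at hpar
  generalize a (lineSnd k) = w at hpar
  have hc := hline.2
  rw [hpar, conicForm_lineParam] at hc
  -- For u = 0 the equation of the conic becomes w² = 0 and the point would be zero; so the slope w
  -- / u is defined.
  have hu : u ≠ 0 := by
    rintro rfl
    have hw : w = 0 := by
      refine pow_eq_zero_iff (two_ne_zero) |>.mp (?_ : w ^ 2 = 0)
      linear_combination hc
    refine ha ?_
    rw [hpar, hw]
    have := smul_lineParam k (0 : ℂ) 0 0
    rw [zero_smul, mul_zero] at this
    exact this.symm
  obtain ⟨ε, hε⟩ := exists_nodeSlope_eq k (x := w / u) (by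
    field_simp
    linear_combination hc)
  refine ⟨k, ε, u, s, hu, hs, ?_, rfl, rfl⟩
  rw [hpar, node, smul_lineParam, ← hε, mul_one, mul_div_cancel₀ _ hu]

/-- A node lies on one member of the pencil only. -/
theorem node_member_unique {k k' : Fin 6} {ε ε' : Bool} {c c' : ℂ} (hc : c ≠ 0)
    (h : c • node k ε = c' • node k' ε') : k = k' := by
  have h1 := member_smul_node k ε c
  have h2 := member_smul_node k' ε' c'
  rw [← h] at h2
  refine member_eq_of_proportional ?_
  -- A point on two different members lies on all of them, which a node does not.
  by_contra hne
  have hF : pencilF (c • node k ε) = 0 := by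
    refine (mul_eq_zero.mp (?_ : (memberF k * memberG k' - memberF k' * memberG k : ℂ) * _ = 0)
      ).resolve_left (sub_ne_zero.mpr hne)
    linear_combination memberG k' * h1 - memberG k * h2
  have hG : pencilG (c • node k ε) = 0 := by
    refine (mul_eq_zero.mp (?_ : (memberF k * memberG k' - memberF k' * memberG k : ℂ) * _ = 0)
      ).resolve_left (sub_ne_zero.mpr hne)
    linear_combination memberF k * h2 - memberF k' * h1
  have h3 := other_smul_node k ε c
  rw [hF, hG, mul_zero, mul_zero, add_zero] at h3
  exact mul_ne_zero (pow_ne_zero 3 hc) (one_sub_nodeSlope_sq_ne_zero k ε) h3.symm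

theorem smul_node_injective {k : Fin 6} {ε ε' : Bool} {c c' : ℂ} (hc : c ≠ 0)
    (h : c • node k ε = c' • node k ε') : c = c' ∧ ε = ε' := by
  rw [node, node, smul_lineParam, smul_lineParam] at h
  have h1 := congrFun h (lineFst k)
  have h2 := congrFun h (lineSnd k)
  rw [lineParam_lineFst, lineParam_lineFst, mul_one, mul_one] at h1
  rw [lineParam_lineSnd, lineParam_lineSnd, ← h1] at h2
  exact ⟨h1, nodeSlope_injective k (mul_left_cancel₀ hc h2)⟩

end Nodes

/-! ### The singular points -/

section SingularPoints

/-- The member through both nodes imposes no condition on the relative factor s. The second member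
requires (1 - ρ²) + s³(1 - ρ'²) = 0, whence a cube root and, later, a threefold choice. -/
theorem exists_nodeScale (k : Fin 6) (ε ε' : Bool) :
    ∃ s : ℂ, s ^ 3 = -(1 - nodeSlope k ε ^ 2) / (1 - nodeSlope k ε' ^ 2) :=
  IsAlgClosed.exists_pow_nat_eq _ (by norm_num)

/-- A number `s` such that the two nodes of the `k`-th member, the second one multiplied by `s`,
are the two parts of a point of `Y'`. -/
noncomputable def nodeScale (k : Fin 6) (ε ε' : Bool) : ℂ := (exists_nodeScale k ε ε').choose

theorem nodeScale_pow (k : Fin 6) (ε ε' : Bool) :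
    nodeScale k ε ε' ^ 3 * (1 - nodeSlope k ε' ^ 2) = -(1 - nodeSlope k ε ^ 2) := by
  rw [nodeScale, (exists_nodeScale k ε ε').choose_spec,
    div_mul_cancel₀ _ (one_sub_nodeSlope_sq_ne_zero k ε')]

theorem nodeScale_ne_zero (k : Fin 6) (ε ε' : Bool) : nodeScale k ε ε' ≠ 0 := by
  intro h
  have := nodeScale_pow k ε ε'
  rw [h] at this
  exact one_sub_nodeSlope_sq_ne_zero k ε (by linear_combination this)

/-- A primitive third root of unity. -/
noncomputable def omega : ℂ := Complex.exp (2 * Real.pi * Complex.I / (3 : ℕ))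

theorem isPrimitiveRoot_omega : IsPrimitiveRoot omega 3 :=
  Complex.isPrimitiveRoot_exp 3 (by norm_num)

/-- The index set of the singular points: a reducible member of the pencil, two of its nodes, and a
third root of unity. -/
abbrev SingularIndex : Type := Fin 6 × Bool × Bool × Fin 3

/-- The ratio of the two parts of a singular point. -/
noncomputable def singularScale (i : SingularIndex) : ℂ :=
  nodeScale i.1 i.2.1 i.2.2.1 * omega ^ (i.2.2.2 : ℕ)

theorem singularScale_ne_zero (i : SingularIndex) : singularScale i ≠ 0 :=
  mul_ne_zero (nodeScale_ne_zero _ _ _) (pow_ne_zero _ (isPrimitiveRoot_omega.ne_zero (by norm_num)))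

theorem singularScale_pow (i : SingularIndex) :
    singularScale i ^ 3 * (1 - nodeSlope i.1 i.2.2.1 ^ 2) = -(1 - nodeSlope i.1 i.2.1 ^ 2) := by
  rw [← nodeScale_pow i.1 i.2.1 i.2.2.1, singularScale, mul_pow, ← pow_mul, mul_comm _ 3, pow_mul,
    isPrimitiveRoot_omega.pow_eq_one, one_pow, mul_one]

/-- Homogeneous coordinates of the singular points. -/
noncomputable def singularVec (i : SingularIndex) : Fin 6 → ℂ :=
  joinParts (node i.1 i.2.1) (singularScale i • node i.1 i.2.2.1)

theorem singularVec_ne_zero (i : SingularIndex) : singularVec i ≠ 0 := by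
  intro h
  refine node_ne_zero i.1 i.2.1 ?_
  have := congrArg partA h
  rw [singularVec, partA_joinParts] at this
  rw [this]
  funext j; fin_cases j <;> rfl

/-- The singular points. -/
noncomputable def singularPoint (i : SingularIndex) : ProjSpace 5 :=
  Projectivization.mk ℂ (singularVec i) (singularVec_ne_zero i)

theorem pencil_singularVec (i : SingularIndex) (c : ℂ) :
    eval (c • singularVec i) A1' = 0 ∧ eval (c • singularVec i) A2' = 0 := by
  rw [eval_A1', eval_A2', singularVec, smul_joinParts, partA_joinParts, partB_joinParts, smul_smul]
  refine eq_zero_of_member_other i.1 ?_ ?_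
  · linear_combination member_smul_node i.1 i.2.1 c +
      member_smul_node i.1 i.2.2.1 (c * singularScale i)
  · linear_combination other_smul_node i.1 i.2.1 c +
      other_smul_node i.1 i.2.2.1 (c * singularScale i) + c ^ 3 * singularScale_pow i

theorem singularPoint_mem (i : SingularIndex) : singularPoint i ∈ singularLocus idealY' 2 := by
  rw [mem_singularLocus_iff]
  obtain ⟨c, hc⟩ := Projectivization.exists_smul_eq_mk_rep ℂ (singularVec i) (singularVec_ne_zero i)
  refine ⟨?_, memberF i.1, memberG i.1, ?_, ?_, ?_⟩
  · rw [mem_Y'_iff, singularPoint, ← hc, Units.smul_def]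
    exact pencil_singularVec i c
  · by_contra! h
    have := member_det_sq (R := ℂ) i.1
    rw [h.1, h.2] at this
    norm_num at this
  · rw [singularPoint, ← hc, Units.smul_def, singularVec, smul_joinParts, partA_joinParts]
    exact isCritical_smul_node ..
  · rw [singularPoint, ← hc, Units.smul_def, singularVec, smul_joinParts, partB_joinParts, smul_smul]
    exact isCritical_smul_node ..

theorem singularPoint_injective : Function.Injective singularPoint := by
  rintro ⟨k, ε, ε', j⟩ ⟨k₂, ε₂, ε₂', j₂⟩ h
  rw [singularPoint, singularPoint, Projectivization.mk_eq_mk_iff'] at h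
  obtain ⟨c, hc⟩ := h
  have ha := congrArg partA hc
  have hb := congrArg partB hc
  rw [singularVec, singularVec, smul_joinParts] at ha hb
  rw [partA_joinParts, partA_joinParts] at ha
  rw [partB_joinParts, partB_joinParts, smul_smul] at hb
  simp only at ha hb
  have ha' : (1 : ℂ) • node k ε = c • node k₂ ε₂ := by rw [one_smul, ha]
  obtain rfl := node_member_unique one_ne_zero ha'
  -- The nodes are normalized to have first parameter 1, so the projective factor `c` is 1.
  obtain ⟨rfl, rfl⟩ := smul_node_injective one_ne_zero ha'
  rw [one_mul] at hb
  obtain ⟨hs, rfl⟩ := smul_node_injective (singularScale_ne_zero _) hb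
  simp only [singularScale] at hs
  have hj := isPrimitiveRoot_omega.pow_inj j₂.2 j.2 (mul_left_cancel₀ (nodeScale_ne_zero _ _ _) hs)
  rw [Fin.ext hj.symm]

theorem pencil_smul_node_ne_zero (k : Fin 6) (ε : Bool) {c : ℂ} (hc : c ≠ 0) :
    ¬ (pencilF (c • node k ε) = 0 ∧ pencilG (c • node k ε) = 0) := by
  rintro ⟨hF, hG⟩
  have h := other_smul_node k ε c
  rw [hF, hG, mul_zero, mul_zero, add_zero] at h
  exact mul_ne_zero (pow_ne_zero 3 hc) (one_sub_nodeSlope_sq_ne_zero k ε) h.symm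

theorem exists_singularPoint_eq {p : ProjSpace 5} (hp : p ∈ singularLocus idealY' 2) :
    ∃ i, singularPoint i = p := by
  rw [mem_singularLocus_iff, mem_Y'_iff, eval_A1', eval_A2'] at hp
  obtain ⟨⟨hF, hG⟩, l, m, hlm, hA, hB⟩ := hp
  have hp0 := joinParts_partA_partB p.rep
  have hrep := p.rep_nonzero
  have hmk : ∀ h, Projectivization.mk ℂ p.rep h = p := fun _ => p.mk_rep
  generalize p.rep = v at *
  generalize partA v = a at *
  generalize partB v = b at *
  subst hp0
  have hF0 : pencilF (0 : Fin 3 → ℂ) = 0 := by simp [pencilF]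
  have hG0 : pencilG (0 : Fin 3 → ℂ) = 0 := by simp [pencilG]
  have h0 : joinParts (0 : Fin 3 → ℂ) 0 = 0 := by funext j; fin_cases j <;> rfl
  -- If one part were zero, the other would be a node lying on every member of the pencil.
  have ha : a ≠ 0 := by
    rintro rfl
    have hb : b ≠ 0 := by rintro rfl; exact hrep h0
    obtain ⟨k, ε, c, s, hc, hs, rfl, -⟩ := exists_node_of_isCritical hlm hb hB
    rw [hF0, zero_add] at hF
    rw [hG0, zero_add] at hG
    exact pencil_smul_node_ne_zero k ε hc ⟨hF, hG⟩
  have hb : b ≠ 0 := by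
    rintro rfl
    obtain ⟨k, ε, c, s, hc, hs, rfl, -⟩ := exists_node_of_isCritical hlm ha hA
    rw [hF0, add_zero] at hF
    rw [hG0, add_zero] at hG
    exact pencil_smul_node_ne_zero k ε hc ⟨hF, hG⟩
  obtain ⟨k, ε, c, s, hc, hs, rfl, hl, hm⟩ := exists_node_of_isCritical hlm ha hA
  obtain ⟨k', ε', d, s', hd, hs', rfl, hl', hm'⟩ := exists_node_of_isCritical hlm hb hB
  obtain rfl : k = k' := by
    refine member_eq_of_proportional (mul_left_cancel₀ (mul_ne_zero hs hs') ?_)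
    rw [hl] at hl'
    rw [hm] at hm'
    linear_combination -(s * memberF k) * hm' + (s * memberG k) * hl'
  have hcd : c ^ 3 * (1 - nodeSlope k ε ^ 2) + d ^ 3 * (1 - nodeSlope k ε' ^ 2) = 0 := by
    rw [← other_smul_node, ← other_smul_node]
    linear_combination otherF k * hF + otherG k * hG
  have hs0 := nodeScale_ne_zero k ε ε'
  have hroot : (d / c / nodeScale k ε ε') ^ 3 = 1 := by
    have h1 := nodeScale_pow k ε ε'
    have h2 := one_sub_nodeSlope_sq_ne_zero k ε'
    have h3 : d ^ 3 = c ^ 3 * nodeScale k ε ε' ^ 3 := by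
      refine mul_right_cancel₀ h2 ?_
      linear_combination hcd - c ^ 3 * h1
    rw [div_pow, div_pow, h3]
    field_simp
  obtain ⟨j, hj, hjr⟩ := isPrimitiveRoot_omega.eq_pow_of_pow_eq_one hroot
  refine ⟨(k, ε, ε', ⟨j, hj⟩), ?_⟩
  rw [← hmk hrep, singularPoint, Projectivization.mk_eq_mk_iff']
  refine ⟨c⁻¹, ?_⟩
  rw [singularVec, smul_joinParts, smul_smul, smul_smul, inv_mul_cancel₀ hc, one_smul]
  congr 2
  simp only [singularScale]
  rw [hjr]
  field_simp

theorem singularLocus_eq_range : singularLocus idealY' 2 = Set.range singularPoint := by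
  ext p
  constructor
  · intro hp
    exact exists_singularPoint_eq hp
  · rintro ⟨i, rfl⟩
    exact singularPoint_mem i

theorem ncard_singularLocus : (singularLocus idealY' 2).ncard = 72 := by
  rw [singularLocus_eq_range, Set.ncard_range_of_injective singularPoint_injective]
  simp

end SingularPoints

/-! ### Evaluation at dual numbers -/

section DualNumbers

open TrivSqZeroExt

/-- The tangent vector `d` at `w`, as a point with coordinates in the dual numbers. -/
noncomputable def tangentPoint {υ K : Type*} [CommRing K] (w d : υ → K) (j : υ) : DualNumber K :=
  inl (w j) + inr (d j)

/-- Taylor's formula with ε² = 0. Identities that hold over every commutative ring, such as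
`other_lineParam`, can thus be differentiated by substituting w + εd. -/
theorem aeval_tangentPoint {υ K : Type*} [Fintype υ] [Field K] (w d : υ → K)
    (F : MvPolynomial υ K) :
    aeval (tangentPoint w d) F = inl (eval w F) + inr (dirDeriv w d F) := by
  induction F using MvPolynomial.induction_on with
  | C c =>
    rw [algHom_C, eval_C, dirDeriv_C, inr_zero, add_zero]
    rfl
  | add F G hF hG =>
    rw [map_add, hF, hG, map_add, dirDeriv_add, inl_add, inr_add]
    ring
  | mul_X F j hF =>
    rw [map_mul, hF, aeval_X, dirDeriv_mul, dirDeriv_X, map_mul, eval_X, tangentPoint]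
    ext
    · simp
    · simp
      ring

/-- The evaluation of polynomials in six variables at a tangent vector. -/
noncomputable def tangentEval (w d : Fin 6 → ℂ) : CoordRing 5 →+* DualNumber ℂ :=
  (aeval (tangentPoint w d)).toRingHom

theorem tangentEval_apply (w d : Fin 6 → ℂ) (F : CoordRing 5) :
    tangentEval w d F = inl (eval w F) + inr (dirDeriv w d F) := aeval_tangentPoint w d F

theorem tangentEval_comp_partA (w d : Fin 6 → ℂ) :
    tangentEval w d ∘ partA (X : Fin 6 → CoordRing 5) =
      tangentPoint (partA w) (partA d) := by
  funext i; fin_cases i <;> simp [partA, tangentPoint, tangentEval]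

theorem tangentEval_comp_partB (w d : Fin 6 → ℂ) :
    tangentEval w d ∘ partB (X : Fin 6 → CoordRing 5) =
      tangentPoint (partB w) (partB d) := by
  funext i; fin_cases i <;> simp [partB, tangentPoint, tangentEval]

theorem fst_nodeTrace (k : Fin 6) : fst (nodeTrace k : DualNumber ℂ) = nodeTrace k := by
  fin_cases k <;> simp [nodeTrace] <;> rfl

theorem snd_nodeTrace (k : Fin 6) : snd (nodeTrace k : DualNumber ℂ) = 0 := by
  fin_cases k <;> simp [nodeTrace] <;> rfl

theorem snd_lineForm (k : Fin 6) (a b : Fin 3 → ℂ) :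
    snd (lineForm k (tangentPoint a b)) = lineForm k b := by
  fin_cases k <;> simp [lineForm, tangentPoint]

/-- The tangent vectors at a node that are tangent to both the line and the conic are the multiples
of the node. -/
theorem eq_smul_node_of_tangent {k : Fin 6} {ε : Bool} {t : ℂ} (ht : t ≠ 0) {b : Fin 3 → ℂ}
    (h₁ : lineForm k (tangentPoint (t • node k ε) b) = 0)
    (h₂ : snd (conicForm k (tangentPoint (t • node k ε) b)) = 0) :
    b = b (lineFst k) • node k ε := by
  -- The tangent vector is a point of the line over the dual numbers. There the conic becomes the
  -- quadratic of the nodes, whose derivative t(2ρ + T) in the second parameter is nonzero.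
  have hT := lineParam_of_lineForm_eq_zero k _ h₁
  have hb := lineParam_of_lineForm_eq_zero k b (by rw [← snd_lineForm, h₁, snd_zero])
  rw [hT, conicForm_lineParam] at h₂
  have e₁ : (t • node k ε) (lineFst k) = t := by
    rw [node, smul_lineParam, lineParam_lineFst, mul_one]
  have e₂ : (t • node k ε) (lineSnd k) = t * nodeSlope k ε := by
    rw [node, smul_lineParam, lineParam_lineSnd]
  simp only [tangentPoint, e₁, e₂] at h₂
  simp [pow_two, fst_nodeTrace, snd_nodeTrace] at h₂
  have h3 : (t * (2 * nodeSlope k ε + nodeTrace k)) *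
      (b (lineSnd k) - b (lineFst k) * nodeSlope k ε) = 0 := by
    linear_combination h₂ - 2 * t * b (lineFst k) * nodeSlope_root k ε
  have h4 := sub_eq_zero.mp ((mul_eq_zero.mp h3).resolve_left
    (mul_ne_zero ht (two_mul_nodeSlope_add_ne_zero k ε)))
  rw [node, smul_lineParam, mul_one, ← h4]
  exact hb

theorem other_tangentPoint_lineParam (k : Fin 6) (u w u' w' : ℂ) :
    snd (otherF k * pencilF (tangentPoint (lineParam k u w) (lineParam k u' w')) +
      otherG k * pencilG (tangentPoint (lineParam k u w) (lineParam k u' w'))) =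
      (3 * u ^ 2 - w ^ 2) * u' - 2 * u * w * w' := by
  have h : tangentPoint (lineParam k u w) (lineParam k u' w') =
      lineParam k (inl u + inr u') (inl w + inr w') := by
    funext i
    fin_cases k <;> fin_cases i <;> simp [tangentPoint, lineParam, add_comm]
  rw [h, other_lineParam]
  simp [pow_succ]
  ring

/-- Euler's formula: the radial derivative of a cubic form is three times its value. -/
theorem other_tangentPoint_node (k : Fin 6) (ε : Bool) (t s : ℂ) :
    snd (otherF k * pencilF (tangentPoint (t • node k ε) (s • node k ε)) +
      otherG k * pencilG (tangentPoint (t • node k ε) (s • node k ε))) =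
      3 * s * t ^ 2 * (1 - nodeSlope k ε ^ 2) := by
  rw [node, smul_lineParam, smul_lineParam, other_tangentPoint_lineParam]
  ring

end DualNumbers


/-! ### The singular points are ordinary double points -/

section OrdinaryDoublePoints

open TrivSqZeroExt

/-- The equation of the cubic hypersurface that is the join of the `k`-th reducible member. -/
noncomputable def memberEq (k : Fin 6) : CoordRing 5 := memberF k * A1' + memberG k * A2'

/-- The equation of the join of another member of the pencil. -/
noncomputable def otherEq (k : Fin 6) : CoordRing 5 := otherF k * A1' + otherG k * A2'

theorem memberEq_eq (k : Fin 6) : memberEq k =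
    lineForm k (partA X) * conicForm k (partA X) + lineForm k (partB X) * conicForm k (partB X) := by
  rw [memberEq, ← member_eq_mul, ← member_eq_mul, A1'_eq, A2'_eq]
  ring

theorem otherEq_eq (k : Fin 6) : otherEq k =
    (otherF k * pencilF (partA X) + otherG k * pencilG (partA X)) +
      (otherF k * pencilF (partB X) + otherG k * pencilG (partB X)) := by
  rw [otherEq, A1'_eq, A2'_eq]
  ring

theorem idealY'_eq_span_member_other (k : Fin 6) :
    idealY' = Ideal.span {memberEq k, otherEq k} := by
  have hd := member_det_sq (R := CoordRing 5) k
  refine le_antisymm (Ideal.span_le.mpr ?_) (Ideal.span_le.mpr ?_)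
  · rintro F (rfl | rfl) <;> rw [SetLike.mem_coe, Ideal.mem_span_pair]
    · refine ⟨(memberF k * otherG k - memberG k * otherF k) * otherG k,
        -(memberF k * otherG k - memberG k * otherF k) * memberG k, ?_⟩
      rw [memberEq, otherEq]
      linear_combination A1' * hd
    · refine ⟨-(memberF k * otherG k - memberG k * otherF k) * otherF k,
        (memberF k * otherG k - memberG k * otherF k) * memberF k, ?_⟩
      rw [memberEq, otherEq]
      linear_combination A2' * hd
  · rintro F (rfl | rfl) <;> rw [SetLike.mem_coe, idealY', Ideal.mem_span_pair]
    · exact ⟨_, _, rfl⟩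
    · exact ⟨_, _, rfl⟩

/-- Local coordinates in which the `k`-th member is a sum of squares. -/
noncomputable def nodeCoord (k : Fin 6) : Fin 4 → CoordRing 5 :=
  ![C (1 / 2) * (lineForm k (partA X) + conicForm k (partA X)),
    C (Complex.I / 2) * (lineForm k (partA X) - conicForm k (partA X)),
    C (1 / 2) * (lineForm k (partB X) + conicForm k (partB X)),
    C (Complex.I / 2) * (lineForm k (partB X) - conicForm k (partB X))]

/-- LQ = ((L + Q)/2)² + (i(L - Q)/2)², for both parts. -/
theorem sum_nodeCoord_sq (k : Fin 6) : ∑ s, nodeCoord k s ^ 2 = memberEq k := by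
  rw [memberEq_eq, Fin.sum_univ_four]
  simp only [nodeCoord, Matrix.cons_val, mul_pow, ← C_pow]
  have h1 : ((1 : ℂ) / 2) ^ 2 = 1 / 4 := by norm_num
  have h2 : (Complex.I / 2) ^ 2 = -(1 / 4) := by rw [div_pow, Complex.I_sq]; norm_num
  have h3 : (4 : CoordRing 5) * C (1 / 4) = 1 := by
    rw [← map_ofNat (C : ℂ →+* CoordRing 5) 4, ← C_mul]; norm_num
  rw [h1, h2, C_neg]
  linear_combination (lineForm k (partA X) * conicForm k (partA X) +
    lineForm k (partB X) * conicForm k (partB X)) * h3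

theorem nodeCoord_eq_zero {M : Type*} [AddCommGroup M] [Module ℂ M] (φ : CoordRing 5 →ₗ[ℂ] M)
    (k : Fin 6) (h : ∀ s, φ (nodeCoord k s) = 0) :
    φ (lineForm k (partA X)) = 0 ∧ φ (conicForm k (partA X)) = 0 ∧
      φ (lineForm k (partB X)) = 0 ∧ φ (conicForm k (partB X)) = 0 := by
  have key : ∀ x y : CoordRing 5, φ (C (1 / 2) * (x + y)) = 0 → φ (C (Complex.I / 2) * (x - y)) = 0 →
      φ x = 0 ∧ φ y = 0 := by
    intro x y h1 h2
    rw [← smul_eq_C_mul, map_smul, smul_eq_zero_iff_right (by norm_num)] at h1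
    rw [← smul_eq_C_mul, map_smul, smul_eq_zero_iff_right (by simp)] at h2
    rw [map_add] at h1
    rw [map_sub, sub_eq_zero] at h2
    rw [h2, ← two_smul ℂ, smul_eq_zero_iff_right two_ne_zero] at h1
    exact ⟨h2.trans h1, h1⟩
  have hA := key _ _ (h 0) (h 1)
  have hB := key _ _ (h 2) (h 3)
  exact ⟨hA.1, hA.2, hB.1, hB.2⟩

theorem eval_nodeCoord_singularVec (i : SingularIndex) (s : Fin 4) :
    eval (singularVec i) (nodeCoord i.1 s) = 0 := by
  have h1 : eval (singularVec i) (lineForm i.1 (partA X)) = 0 := by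
    rw [map_lineForm, comp_partA, eval_comp_X, singularVec, partA_joinParts]
    simpa using lineForm_smul_node i.1 i.2.1 1
  have h2 : eval (singularVec i) (conicForm i.1 (partA X)) = 0 := by
    rw [map_conicForm, comp_partA, eval_comp_X, singularVec, partA_joinParts]
    simpa using conicForm_smul_node i.1 i.2.1 1
  have h3 : eval (singularVec i) (lineForm i.1 (partB X)) = 0 := by
    rw [map_lineForm, comp_partB, eval_comp_X, singularVec, partB_joinParts, lineForm_smul_node]
  have h4 : eval (singularVec i) (conicForm i.1 (partB X)) = 0 := by
    rw [map_conicForm, comp_partB, eval_comp_X, singularVec, partB_joinParts, conicForm_smul_node]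
  fin_cases s <;> simp [nodeCoord, h1, h2, h3, h4]

/-- The coordinate used as affine chart at the singular points on the `k`-th member. -/
def chartIndex (k : Fin 6) : Fin 6 := ![1, 2, 3] (lineFst k)

theorem apply_chartIndex {R : Type*} (k : Fin 6) (v : Fin 6 → R) :
    v (chartIndex k) = partA v (lineFst k) := by
  fin_cases k <;> simp [chartIndex, lineFst, partA]

theorem singularVec_chartIndex (i : SingularIndex) : singularVec i (chartIndex i.1) = 1 := by
  rw [apply_chartIndex i.1 (singularVec i), singularVec, partA_joinParts, node_lineFst]

/-- Invertibility of the Jacobian matrix. Tangency to the lines and conics leaves a multiple of the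
node in each part. The chart equation removes the first multiple; the second equation removes the
other, because its radial derivative 3s²(1 - ρ'²) is nonzero. -/
theorem dirDeriv_eq_zero_of_tangent (i : SingularIndex) {d : Fin 6 → ℂ}
    (hx : ∀ s, dirDeriv (singularVec i) d (nodeCoord i.1 s) = 0)
    (ho : dirDeriv (singularVec i) d (otherEq i.1) = 0) (hd : d (chartIndex i.1) = 0) : d = 0 := by
  have e₀ := nodeCoord_eq_zero (aeval (tangentPoint (singularVec i) d)).toLinearMap i.1 fun s => by
    change tangentEval _ _ _ = _
    rw [tangentEval_apply, hx, eval_nodeCoord_singularVec, inl_zero, inr_zero, add_zero]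
  have e : ∀ F : CoordRing 5, (aeval (tangentPoint (singularVec i) d)).toLinearMap F =
      tangentEval (singularVec i) d F := fun _ => rfl
  have pA : partA (singularVec i) = (1 : ℂ) • node i.1 i.2.1 := by
    rw [singularVec, partA_joinParts, one_smul]
  have pB : partB (singularVec i) = singularScale i • node i.1 i.2.2.1 := by
    rw [singularVec, partB_joinParts]
  simp only [e, map_lineForm, map_conicForm, tangentEval_comp_partA,
    tangentEval_comp_partB, pA, pB] at e₀
  obtain ⟨h1, h2, h3, h4⟩ := e₀
  have hA := eq_smul_node_of_tangent one_ne_zero h1 (by rw [h2, snd_zero])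
  have hB := eq_smul_node_of_tangent (singularScale_ne_zero i) h3 (by rw [h4, snd_zero])
  rw [← apply_chartIndex i.1 d, hd, zero_smul] at hA
  have ho' : snd (tangentEval (singularVec i) d (otherEq i.1)) = 0 := by
    rw [tangentEval_apply, ho, inr_zero, add_zero, snd_inl]
  have hmF : tangentEval (singularVec i) d (otherF i.1) =
      (otherF i.1 : DualNumber ℂ) := by
    generalize i.1 = k
    fin_cases k <;> simp [otherF]
  have hmG : tangentEval (singularVec i) d (otherG i.1) =
      (otherG i.1 : DualNumber ℂ) := by
    generalize i.1 = k
    fin_cases k <;> simp [otherG]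
  rw [otherEq_eq, map_add, map_add, map_add, map_mul, map_mul, map_mul, map_mul, map_pencilF,
    map_pencilG, map_pencilF, map_pencilG, tangentEval_comp_partA,
    tangentEval_comp_partB, pA, pB, hmF, hmG, hA, hB, snd_add, other_tangentPoint_node,
    ← zero_smul ℂ (node i.1 i.2.1), other_tangentPoint_node] at ho'
  have hs := singularScale_ne_zero i
  have hn := one_sub_nodeSlope_sq_ne_zero i.1 i.2.2.1
  have hb0 : partB d (lineFst i.1) = 0 := by
    have : partB d (lineFst i.1) * (3 * singularScale i ^ 2 * (1 - nodeSlope i.1 i.2.2.1 ^ 2)) = 0 := by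
      linear_combination ho'
    exact (mul_eq_zero.mp this).resolve_right
      (mul_ne_zero (mul_ne_zero three_ne_zero (pow_ne_zero 2 hs)) hn)
  rw [hb0, zero_smul] at hB
  rw [← joinParts_partA_partB d, hA, hB]
  funext j; fin_cases j <;> rfl

theorem isOrdinaryDoublePoint_singularPoint (i : SingularIndex) :
    IsOrdinaryDoublePoint idealY' 2 (singularPoint i) := by
  refine ⟨singularPoint_mem i, chartIndex i.1, singularVec i, singularVec_ne_zero i, rfl,
    singularVec_chartIndex i, ?_⟩
  -- Six coordinates on affine 6-space: the four `nodeCoord`, in which the reducible member is the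
  -- sum of squares, and the two remaining generators of the ideal of the chart.
  have h := nonempty_adicCompletion_algEquiv (w := singularVec i)
    (finSumFinEquiv : Fin 4 ⊕ Fin 2 ≃ Fin 6) (x := nodeCoord i.1)
    (y := ![otherEq i.1, X (chartIndex i.1) - 1]) (eval_nodeCoord_singularVec i) ?_ ?_
    (∑ s, X s ^ 2) (idealY' ⊔ Ideal.span {X (chartIndex i.1) - 1}) ?_
  · have hq : ((∑ s, X s ^ 2 : MvPolynomial (Fin 4) ℂ) : MvPowerSeries (Fin 4) ℂ) =
        ∑ s, MvPowerSeries.X s ^ 2 := by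
      simp [Fin.sum_univ_four]
    rw [hq] at h
    exact h
  · have h1 := pencil_singularVec i 1
    rw [one_smul] at h1
    refine Fin.forall_fin_two.mpr ⟨?_, ?_⟩
    · simp [otherEq, h1]
    · simp [singularVec_chartIndex]
  · intro d hx hy
    have hy1 := hy 1
    simp at hy1
    exact dirDeriv_eq_zero_of_tangent i hx (hy 0) hy1
  · have hq : aeval (nodeCoord i.1) (∑ s, X s ^ 2 : MvPolynomial (Fin 4) ℂ) = memberEq i.1 := by
      rw [← sum_nodeCoord_sq]
      simp
    rw [hq, idealY'_eq_span_member_other i.1, Ideal.span_insert, sup_assoc, Matrix.range_cons,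
      Matrix.range_cons, Matrix.range_empty, Set.union_empty, Ideal.span_union]

theorem isOrdinaryDoublePoint_of_mem_singularLocus {p : ProjSpace 5}
    (hp : p ∈ singularLocus idealY' 2) : IsOrdinaryDoublePoint idealY' 2 p := by
  obtain ⟨i, rfl⟩ := exists_singularPoint_eq hp
  exact isOrdinaryDoublePoint_singularPoint i

end OrdinaryDoublePoints

/-! ### The dimension of an affine hypersurface -/

namespace MvPolynomial

/-- A maximal ideal contracts to a maximal ideal in one variable less, because the base is a
Jacobson ring, and the height drops by one. -/
theorem height_eq_of_isMaximal {K : Type*} [Field K] {n : ℕ} (M : Ideal (MvPolynomial (Fin n) K))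
    [hM : M.IsMaximal] : M.height = n := by
  induction n with
  | zero =>
    have h : ringKrullDim (MvPolynomial (Fin 0) K) = 0 := by
      rw [MvPolynomial.ringKrullDim_of_isNoetherianRing, ringKrullDim_eq_zero_of_field]
      simp
    have h1 := Ideal.height_le_ringKrullDim_of_ne_top hM.ne_top
    rw [h] at h1
    simpa using h1
  | succ n ih =>
    have hP := Ideal.map_isMaximal_of_equiv (finSuccEquiv K n).toRingEquiv (p := M)
    rw [← (finSuccEquiv K n).toRingEquiv.height_map M]
    generalize M.map (finSuccEquiv K n).toRingEquiv = P at hP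
    have hp : (P.under (MvPolynomial (Fin n) K)).IsMaximal :=
      Polynomial.isMaximal_comap_C_of_isJacobsonRing P
    rw [Polynomial.height_eq_height_add_one (P.under (MvPolynomial (Fin n) K)) P,
      ih (P.under (MvPolynomial (Fin n) K))]
    simp

/-- A nonzerodivisor lowers the dimension by exactly one if it lies in a maximal ideal of full
height, and all maximal ideals have full height. -/
theorem ringKrullDim_quotient_span_singleton {K : Type*} [Field K] {n : ℕ}
    {F : MvPolynomial (Fin (n + 1)) K} (hF : F ≠ 0) (hu : ¬ IsUnit F) :
    ringKrullDim (MvPolynomial (Fin (n + 1)) K ⧸ Ideal.span {F}) = n := by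
  obtain ⟨M, hM, hFM⟩ := exists_max_ideal_of_mem_nonunits hu
  have hdim : ringKrullDim (MvPolynomial (Fin (n + 1)) K) = ((n + 1 : ℕ) : WithBot ℕ∞) := by
    rw [MvPolynomial.ringKrullDim_of_isNoetherianRing, ringKrullDim_eq_zero_of_field]
    simp
  have h := Module.ringKrullDim_quotient_add_one_of_mem_nonZeroDivisors
    (mem_nonZeroDivisors_of_ne_zero hF) (p := M)
    (by rw [height_eq_of_isMaximal, hdim]; rfl) hFM
  rw [hdim] at h
  generalize ringKrullDim (MvPolynomial (Fin (n + 1)) K ⧸ Ideal.span {F}) = x at h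
  induction x with
  | bot => exact absurd h (by rw [WithBot.bot_add]; exact WithBot.bot_ne_coe)
  | coe x =>
    have h' : x + 1 = n + 1 := by exact_mod_cast h
    rw [ENat.add_left_injective_of_ne_top ENat.one_ne_top h']
    rfl

end MvPolynomial

/-! ### Irreducibility of the equation of the surfaces -/

section CubicForm

open TrivSqZeroExt

/-- The cubic form `u³ - u w² + u'³ - u' w'²`. -/
noncomputable def surfaceCubic : MvPolynomial (Fin 4) ℂ :=
  X 0 ^ 3 - X 0 * X 1 ^ 2 + (X 2 ^ 3 - X 2 * X 3 ^ 2)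

/-- A criterion for `F ∉ P²`, where `P` is the kernel of a ring homomorphism that factors the
residue part of a homomorphism to the dual numbers. -/
theorem notMem_ker_sq_of_dualNumber {A B K : Type*} [CommRing A] [CommRing B] [CommRing K]
    (φ : A →+* B) (ψ : A →+* DualNumber K) (θ : B →+* K)
    (h : ∀ a, fst (ψ a) = θ (φ a)) {F : A} (hF : ψ F ≠ 0) : F ∉ RingHom.ker φ ^ 2 := by
  intro hmem
  have hle : RingHom.ker φ ^ 2 ≤ RingHom.ker ψ := by
    rw [pow_two, Ideal.mul_le]
    intro a ha b hb
    rw [RingHom.mem_ker] at ha hb ⊢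
    have ha' : fst (ψ a) = 0 := by rw [h, ha, map_zero]
    have hb' : fst (ψ b) = 0 := by rw [h, hb, map_zero]
    rw [map_mul]
    ext <;> simp [ha', hb']
  exact hF (hle hmem)

theorem irreducible_X_cube_add {A : Type*} [CommRing A] [IsDomain A] {P : Ideal A}
    (hP : P.IsPrime) {a b : A} (ha : a ∈ P) (hb : b ∈ P) (hb2 : b ∉ P ^ 2) :
    Irreducible (Polynomial.X ^ 3 + (Polynomial.C a * Polynomial.X + Polynomial.C b)) := by
  have hdeg : (Polynomial.C a * Polynomial.X + Polynomial.C b).degree < ((3 : ℕ) : WithBot ℕ) :=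
    lt_of_le_of_lt Polynomial.degree_linear_le (by norm_num)
  have hmonic : (Polynomial.X ^ 3 + (Polynomial.C a * Polynomial.X + Polynomial.C b)).Monic :=
    Polynomial.monic_X_pow_add hdeg
  have hnd : (Polynomial.X ^ 3 + (Polynomial.C a * Polynomial.X + Polynomial.C b)).degree =
      ((3 : ℕ) : WithBot ℕ) := by
    rw [Polynomial.degree_add_eq_left_of_degree_lt, Polynomial.degree_X_pow]
    rwa [Polynomial.degree_X_pow]
  refine Polynomial.irreducible_of_eisenstein_criterion hP ?_ ?_ ?_ ?_ hmonic.isPrimitive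
  · rw [hmonic.leadingCoeff]
    exact (Ideal.ne_top_iff_one P).mp hP.ne_top
  · intro n hn
    rw [hnd] at hn
    have hn' : n < 3 := by exact_mod_cast hn
    interval_cases n <;>
      simp [Polynomial.coeff_X, Polynomial.coeff_C, Polynomial.coeff_X_pow, ha, hb]
  · rw [hnd]; norm_num
  · simpa [Polynomial.coeff_X_pow] using hb2

theorem irreducible_surfaceCubic : Irreducible surfaceCubic := by
  rw [← MulEquiv.irreducible_iff (finSuccEquiv ℂ 3)]
  have hS : finSuccEquiv ℂ 3 surfaceCubic = Polynomial.X ^ 3 +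
      (Polynomial.C (-X 0 ^ 2) * Polynomial.X +
        Polynomial.C (X 1 ^ 3 - X 1 * X 2 ^ 2)) := by
    have h1 : (1 : Fin 4) = (0 : Fin 3).succ := rfl
    have h2 : (2 : Fin 4) = (1 : Fin 3).succ := rfl
    have h3 : (3 : Fin 4) = (2 : Fin 3).succ := rfl
    rw [surfaceCubic, h1, h2, h3]
    simp only [map_add, map_sub, map_mul, map_pow, finSuccEquiv_X_zero, finSuccEquiv_X_succ, map_neg]
    ring
  rw [hS]
  -- Eisenstein at the prime of the axis X₀ = X₁ = 0. The constant term has order one along the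
  -- axis, as it takes the value -ε at (0, ε, 1).
  refine irreducible_X_cube_add (RingHom.ker_isPrime (aeval ![0, 0, Polynomial.X] :
    MvPolynomial (Fin 3) ℂ →ₐ[ℂ] Polynomial ℂ).toRingHom) ?_ ?_ ?_
  · rw [RingHom.mem_ker]
    simp
  · rw [RingHom.mem_ker]
    simp
  · refine notMem_ker_sq_of_dualNumber _
      (aeval ![0, inr 1, 1] : MvPolynomial (Fin 3) ℂ →ₐ[ℂ] DualNumber ℂ).toRingHom
      (Polynomial.evalRingHom 1) (fun a => ?_) ?_
    · refine RingHom.congr_fun (f := (fstHom ℂ ℂ ℂ).toRingHom.comp _)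
        (g := (Polynomial.evalRingHom 1).comp _) ?_ a
      refine MvPolynomial.ringHom_ext (fun c => ?_) (fun i => ?_)
      · simp
      · fin_cases i <;> simp
    · intro h
      have := congrArg snd h
      simp [pow_succ] at this

end CubicForm

/-! ### Projective varieties defined by homogeneous prime ideals -/

namespace ProjVar

variable {n : ℕ}

/-- Nonemptiness is needed for the vertex, which lies on the cone only by way of some projective
point. -/
theorem cone_zeroSet_span {s : Set (CoordRing n)} (hs : ∀ F ∈ s, ∃ d, F.IsHomogeneous d)
    (hne : (zeroSet (Ideal.span s)).Nonempty) :
    cone (zeroSet (Ideal.span s)) = zeroLocus ℂ (Ideal.span s) := by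
  ext v
  constructor
  · rintro ⟨p, hp, hv⟩
    exact fun F hF => hp F hF v hv
  · intro hv
    by_cases hv0 : v = 0
    · obtain ⟨p, hp⟩ := hne
      exact ⟨p, hp, hv0 ▸ zero_mem _⟩
    · refine ⟨Projectivization.mk ℂ v hv0, ?_, ?_⟩
      · rw [mk_mem_zeroSet_span_iff hs]
        exact fun F hF => hv F (Ideal.subset_span hF)
      · rw [Projectivization.submodule_mk]
        exact Submodule.mem_span_singleton_self v

/-- The Nullstellensatz on the affine cone. -/
theorem idealOf_zeroSet_span {s : Set (CoordRing n)} (hs : ∀ F ∈ s, ∃ d, F.IsHomogeneous d)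
    (hne : (zeroSet (Ideal.span s)).Nonempty) (hp : (Ideal.span s).IsPrime) :
    idealOf (zeroSet (Ideal.span s)) = Ideal.span s := by
  rw [idealOf, cone_zeroSet_span hs hne]
  exact MvPolynomial.IsPrime.vanishingIdeal_zeroLocus _

end ProjVar

/-! ### The surfaces -/

section Surfaces

/-- The generators of the ideal of the surface in the join of the two copies of the `k`-th line. -/
noncomputable def surfaceGen (k : Fin 6) : Fin 3 → CoordRing 5 :=
  ![lineForm k (partA X), lineForm k (partB X), otherEq k]

/-- The ideal of the surface in the join of the two copies of the `k`-th line. -/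
noncomputable def surfaceIdeal (k : Fin 6) : Ideal (CoordRing 5) :=
  Ideal.span (Set.range (surfaceGen k))

/-- The generic point of the join of the two copies of the `k`-th line. -/
noncomputable def joinLineParam (k : Fin 6) : Fin 6 → MvPolynomial (Fin 4) ℂ :=
  joinParts (lineParam k (X 0) (X 1)) (lineParam k (X 2) (X 3))

/-- The restriction of polynomials to the join of the two copies of the `k`-th line. -/
noncomputable def restrictJoin (k : Fin 6) : CoordRing 5 →+* MvPolynomial (Fin 4) ℂ :=
  (aeval (joinLineParam k)).toRingHom

/-- The extension of polynomials on the join of the two copies of the `k`-th line. -/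
noncomputable def extendJoin (k : Fin 6) : MvPolynomial (Fin 4) ℂ →+* CoordRing 5 :=
  (aeval ![partA X (lineFst k), partA X (lineSnd k), partB X (lineFst k),
    partB X (lineSnd k)]).toRingHom

theorem restrictJoin_comp_X (k : Fin 6) :
    restrictJoin k ∘ (X : Fin 6 → CoordRing 5) = joinLineParam k := by
  funext j; simp [restrictJoin]

theorem restrictJoin_comp_partA (k : Fin 6) :
    restrictJoin k ∘ partA (X : Fin 6 → CoordRing 5) = lineParam k (X 0) (X 1) := by
  rw [comp_partA, restrictJoin_comp_X, joinLineParam, partA_joinParts]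

theorem restrictJoin_comp_partB (k : Fin 6) :
    restrictJoin k ∘ partB (X : Fin 6 → CoordRing 5) = lineParam k (X 2) (X 3) := by
  rw [comp_partB, restrictJoin_comp_X, joinLineParam, partB_joinParts]

theorem restrictJoin_extendJoin (k : Fin 6) (F : MvPolynomial (Fin 4) ℂ) :
    restrictJoin k (extendJoin k F) = F := by
  have h : (restrictJoin k).comp (extendJoin k) = RingHom.id _ := by
    refine MvPolynomial.ringHom_ext (fun c => ?_) (fun i => ?_)
    · simp [restrictJoin, extendJoin]
    · have hA := fun j => congrFun (restrictJoin_comp_partA k) j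
      have hB := fun j => congrFun (restrictJoin_comp_partB k) j
      simp only [Function.comp_apply] at hA hB
      fin_cases i <;> simp [extendJoin, hA, hB, lineParam_lineFst, lineParam_lineSnd]
  exact RingHom.congr_fun h F

theorem map_otherF {R S : Type*} [CommRing R] [CommRing S] (φ : R →+* S) (k : Fin 6) :
    φ (otherF k) = otherF k := by
  fin_cases k <;> simp [otherF]

theorem map_otherG {R S : Type*} [CommRing R] [CommRing S] (φ : R →+* S) (k : Fin 6) :
    φ (otherG k) = otherG k := by
  fin_cases k <;> simp [otherG]

theorem restrictJoin_otherEq (k : Fin 6) : restrictJoin k (otherEq k) = surfaceCubic := by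
  rw [otherEq_eq, map_add, map_add, map_add, map_mul, map_mul, map_mul, map_mul, map_pencilF,
    map_pencilG, map_pencilF, map_pencilG, restrictJoin_comp_partA, restrictJoin_comp_partB,
    map_otherF, map_otherG, other_lineParam, other_lineParam, surfaceCubic]

/-- Modulo the two linear forms the generic point lies on the join of the lines, hence equals its
own parametrization. -/
theorem sub_extendJoin_mem (k : Fin 6) (F : CoordRing 5) :
    F - extendJoin k (restrictJoin k F) ∈ surfaceIdeal k := by
  rw [← Ideal.Quotient.mk_eq_mk_iff_sub_mem]
  have h : Ideal.Quotient.mk (surfaceIdeal k) =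
      ((Ideal.Quotient.mk (surfaceIdeal k)).comp (extendJoin k)).comp (restrictJoin k) := by
    have hA : lineForm k (Ideal.Quotient.mk (surfaceIdeal k) ∘ partA X) = 0 := by
      rw [← map_lineForm, Ideal.Quotient.eq_zero_iff_mem]
      exact Ideal.subset_span ⟨0, rfl⟩
    have hB : lineForm k (Ideal.Quotient.mk (surfaceIdeal k) ∘ partB X) = 0 := by
      rw [← map_lineForm, Ideal.Quotient.eq_zero_iff_mem]
      exact Ideal.subset_span ⟨1, rfl⟩
    have eA := lineParam_of_lineForm_eq_zero k _ hA
    have eB := lineParam_of_lineForm_eq_zero k _ hB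
    refine MvPolynomial.ringHom_ext (fun c => ?_) (fun i => ?_)
    · simp [restrictJoin, extendJoin]
    · have e : (Ideal.Quotient.mk (surfaceIdeal k)).comp (extendJoin k) ∘ joinLineParam k =
          Ideal.Quotient.mk (surfaceIdeal k) ∘ X := by
        rw [← joinParts_partA_partB (Ideal.Quotient.mk (surfaceIdeal k) ∘ X), ← comp_partA,
          ← comp_partB, eA, eB, ← joinParts_partA_partB
            ((Ideal.Quotient.mk (surfaceIdeal k)).comp (extendJoin k) ∘ joinLineParam k),
          ← comp_partA, ← comp_partB, joinLineParam, partA_joinParts, partB_joinParts,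
          map_lineParam, map_lineParam]
        simp [extendJoin]
      have := congrFun e i
      simp only [Function.comp_apply] at this
      rw [← this, RingHom.comp_apply _ (restrictJoin k)]
      simp [restrictJoin]
  exact RingHom.congr_fun h F

/-- The homogeneous coordinate ring is therefore that of the cubic surface in ℙ³, from which
primality and dimension are inherited. -/
theorem surfaceIdeal_eq_comap (k : Fin 6) :
    surfaceIdeal k = (Ideal.span {surfaceCubic}).comap (restrictJoin k) := by
  refine le_antisymm (Ideal.span_le.mpr ?_) ?_
  · rintro _ ⟨i, rfl⟩
    rw [SetLike.mem_coe, Ideal.mem_comap]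
    fin_cases i
    · change restrictJoin k (lineForm k (partA X)) ∈ _
      rw [map_lineForm, restrictJoin_comp_partA, lineForm_lineParam]
      exact zero_mem _
    · change restrictJoin k (lineForm k (partB X)) ∈ _
      rw [map_lineForm, restrictJoin_comp_partB, lineForm_lineParam]
      exact zero_mem _
    · change restrictJoin k (otherEq k) ∈ _
      rw [restrictJoin_otherEq]
      exact Ideal.mem_span_singleton_self _
  · intro F hF
    rw [Ideal.mem_comap, Ideal.mem_span_singleton] at hF
    obtain ⟨g, hg⟩ := hF
    have h1 := sub_extendJoin_mem k F
    have h2 := sub_extendJoin_mem k (otherEq k)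
    have h3 : otherEq k ∈ surfaceIdeal k := Ideal.subset_span ⟨2, rfl⟩
    rw [restrictJoin_otherEq] at h2
    have h4 : extendJoin k surfaceCubic ∈ surfaceIdeal k := by
      have := sub_mem h3 h2
      rwa [sub_sub_cancel] at this
    have h5 : extendJoin k (restrictJoin k F) ∈ surfaceIdeal k := by
      rw [hg, map_mul]
      exact Ideal.mul_mem_right _ _ h4
    have := add_mem h1 h5
    rwa [sub_add_cancel] at this

theorem isPrime_surfaceIdeal (k : Fin 6) : (surfaceIdeal k).IsPrime := by
  have : (Ideal.span {surfaceCubic}).IsPrime := by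
    rw [Ideal.span_singleton_prime irreducible_surfaceCubic.ne_zero]
    exact irreducible_surfaceCubic.prime
  rw [surfaceIdeal_eq_comap]
  exact Ideal.comap_isPrime _ _

theorem ringKrullDim_quotient_surfaceIdeal (k : Fin 6) :
    ringKrullDim (CoordRing 5 ⧸ surfaceIdeal k) = 3 := by
  have hker : RingHom.ker ((Ideal.Quotient.mk (Ideal.span {surfaceCubic})).comp (restrictJoin k)) =
      surfaceIdeal k := by
    rw [surfaceIdeal_eq_comap, ← RingHom.comap_ker, Ideal.mk_ker]
  have hsurj : Function.Surjective
      ((Ideal.Quotient.mk (Ideal.span {surfaceCubic})).comp (restrictJoin k)) :=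
    Ideal.Quotient.mk_surjective.comp fun F => ⟨_, restrictJoin_extendJoin k F⟩
  rw [← hker, ringKrullDim_eq_of_ringEquiv (RingHom.quotientKerEquivOfSurjective hsurj),
    ringKrullDim_quotient_span_singleton irreducible_surfaceCubic.ne_zero
      irreducible_surfaceCubic.not_isUnit]
  rfl

theorem isHomogeneous_lineForm {k : Fin 6} {a : Fin 3 → CoordRing 5} {d : ℕ}
    (ha : ∀ i, (a i).IsHomogeneous d) : (lineForm k a).IsHomogeneous d := by
  fin_cases k
  · exact (ha 0).add (ha 1)
  · exact ((ha 0).add (ha 2)).neg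
  · exact ((ha 1).add (ha 2)).neg
  · exact (ha 2).sub (ha 1)
  · exact (ha 1).sub (ha 0)
  · exact (ha 0).sub (ha 2)

theorem isHomogeneous_otherEq (k : Fin 6) : (otherEq k).IsHomogeneous 3 := by
  have h1 := isHomogeneous_A1'
  have h2 := isHomogeneous_A2'
  fin_cases k <;> simp [otherEq, otherF, otherG, h1, h2.neg]

theorem isHomogeneous_surfaceGen (k : Fin 6) :
    ∀ F ∈ Set.range (surfaceGen k), ∃ d, F.IsHomogeneous d := by
  rintro _ ⟨i, rfl⟩
  fin_cases i
  · refine ⟨1, isHomogeneous_lineForm fun i => ?_⟩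
    fin_cases i <;> exact isHomogeneous_X _ _
  · refine ⟨1, isHomogeneous_lineForm fun i => ?_⟩
    fin_cases i <;> exact isHomogeneous_X _ _
  · exact ⟨3, isHomogeneous_otherEq k⟩

theorem singularPoint_mem_surface (i : SingularIndex) :
    singularPoint i ∈ zeroSet (surfaceIdeal i.1) := by
  rw [singularPoint, surfaceIdeal, mk_mem_zeroSet_span_iff (isHomogeneous_surfaceGen i.1)]
  have h1 := pencil_singularVec i 1
  rw [one_smul] at h1
  rintro _ ⟨j, rfl⟩
  fin_cases j
  · change eval _ (lineForm i.1 (partA X)) = 0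
    rw [map_lineForm, comp_partA, eval_comp_X, singularVec, partA_joinParts, node,
      lineForm_lineParam]
  · change eval _ (lineForm i.1 (partB X)) = 0
    rw [map_lineForm, comp_partB, eval_comp_X, singularVec, partB_joinParts, lineForm_smul_node]
  · change eval _ (otherEq i.1) = 0
    simp [otherEq, h1]

theorem idealY'_le_surfaceIdeal (k : Fin 6) : idealY' ≤ surfaceIdeal k := by
  rw [idealY'_eq_span_member_other k, Ideal.span_le]
  rintro F (rfl | rfl)
  · rw [SetLike.mem_coe, memberEq_eq]
    exact add_mem (Ideal.mul_mem_right _ _ (Ideal.subset_span ⟨0, rfl⟩))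
      (Ideal.mul_mem_right _ _ (Ideal.subset_span ⟨1, rfl⟩))
  · exact Ideal.subset_span ⟨2, rfl⟩

theorem surface_subset (k : Fin 6) : zeroSet (surfaceIdeal k) ⊆ Y' :=
  fun _ hp F hF => hp F (idealY'_le_surfaceIdeal k hF)

theorem dirDeriv_lineForm_partA (k : Fin 6) (v d : Fin 6 → ℂ) :
    dirDeriv v d (lineForm k (partA X) : CoordRing 5) = lineForm k (partA d) := by
  have h := congrArg TrivSqZeroExt.snd (tangentEval_apply v d (lineForm k (partA X)))
  rw [map_lineForm, tangentEval_comp_partA, snd_lineForm] at h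
  simpa using h.symm

theorem dirDeriv_lineForm_partB (k : Fin 6) (v d : Fin 6 → ℂ) :
    dirDeriv v d (lineForm k (partB X) : CoordRing 5) = lineForm k (partB d) := by
  have h := congrArg TrivSqZeroExt.snd (tangentEval_apply v d (lineForm k (partB X)))
  rw [map_lineForm, tangentEval_comp_partB, snd_lineForm] at h
  simpa using h.symm

theorem dirDeriv_otherEq (k : Fin 6) (u w u' w' x y x' y' : ℂ) :
    dirDeriv (joinParts (lineParam k u w) (lineParam k u' w'))
      (joinParts (lineParam k x y) (lineParam k x' y')) (otherEq k) =
      (3 * u ^ 2 - w ^ 2) * x - 2 * u * w * y + ((3 * u' ^ 2 - w' ^ 2) * x' - 2 * u' * w' * y') := by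
  have h := congrArg TrivSqZeroExt.snd (tangentEval_apply
    (joinParts (lineParam k u w) (lineParam k u' w'))
    (joinParts (lineParam k x y) (lineParam k x' y')) (otherEq k))
  rw [otherEq_eq, map_add, map_add, map_add, map_mul, map_mul, map_mul, map_mul, map_pencilF,
    map_pencilG, map_pencilF, map_pencilG, tangentEval_comp_partA, tangentEval_comp_partB,
    map_otherF, map_otherG, TrivSqZeroExt.snd_add, partA_joinParts, partA_joinParts, partB_joinParts,
    partB_joinParts, other_tangentPoint_lineParam, other_tangentPoint_lineParam] at h
  rw [h, otherEq_eq]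
  simp

theorem lineParam_zero (k : Fin 6) : lineParam k (0 : ℂ) 0 = 0 := by
  have := smul_lineParam k (0 : ℂ) 0 0
  rw [zero_smul, mul_zero] at this
  exact this.symm

theorem lineForm_zero (k : Fin 6) : lineForm k (0 : Fin 3 → ℂ) = 0 := by
  rw [← lineParam_zero k, lineForm_lineParam]

theorem exists_lineForm_eq_one (k : Fin 6) : ∃ a : Fin 3 → ℂ, lineForm k a = 1 := by
  fin_cases k
  · exact ⟨![1, 0, 0], by simp [lineForm]⟩
  · exact ⟨![-1, 0, 0], by simp [lineForm]⟩
  · exact ⟨![0, -1, 0], by simp [lineForm]⟩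
  · exact ⟨![0, 0, 1], by simp [lineForm]⟩
  · exact ⟨![0, 1, 0], by simp [lineForm]⟩
  · exact ⟨![1, 0, 0], by simp [lineForm]⟩

theorem joinParts_zero : joinParts (0 : Fin 3 → ℂ) 0 = 0 := by
  funext j; fin_cases j <;> rfl

/-- The origin is the only critical point of u³ - uw²; this is the smoothness of the cubic surface.
-/
theorem eq_zero_of_partials {u w c : ℂ} (hc : c ≠ 0) (h₁ : c * (3 * u ^ 2 - w ^ 2) = 0)
    (h₂ : c * (2 * u * w) = 0) : u = 0 ∧ w = 0 := by
  have e₁ := (mul_eq_zero.mp h₁).resolve_left hc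
  have e₂ := (mul_eq_zero.mp h₂).resolve_left hc
  rcases mul_eq_zero.mp e₂ with h | h
  · have hu : u = 0 := (mul_eq_zero.mp h).resolve_left two_ne_zero
    subst hu
    exact ⟨rfl, pow_eq_zero_iff two_ne_zero |>.mp (by linear_combination -e₁)⟩
  · subst h
    exact ⟨pow_eq_zero_iff two_ne_zero |>.mp (by linear_combination (1 / 3) * e₁), rfl⟩

theorem isSmoothPoint_surface (k : Fin 6) {p : ProjSpace 5} (hp : p ∈ zeroSet (surfaceIdeal k)) :
    IsSmoothPoint (surfaceIdeal k) 3 p := by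
  have hz : ∀ F ∈ Set.range (surfaceGen k), eval p.rep F = 0 :=
    (mem_zeroSet_span_iff (isHomogeneous_surfaceGen k) p).mp hp
  rw [surfaceIdeal, isSmoothPoint_span_range_iff _ p hp, Fintype.linearIndependent_iff]
  intro c hc
  have hA : lineForm k (partA p.rep) = 0 := by
    have := hz _ ⟨0, rfl⟩
    change eval _ (lineForm k (partA X)) = 0 at this
    rwa [map_lineForm, comp_partA, eval_comp_X] at this
  have hB : lineForm k (partB p.rep) = 0 := by
    have := hz _ ⟨1, rfl⟩
    change eval _ (lineForm k (partB X)) = 0 at this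
    rwa [map_lineForm, comp_partB, eval_comp_X] at this
  have hpair : ∀ d : Fin 6 → ℂ, c 0 * lineForm k (partA d) + c 1 * lineForm k (partB d) +
      c 2 * dirDeriv p.rep d (otherEq k) = 0 := by
    intro d
    rw [← dirDeriv_lineForm_partA k p.rep, ← dirDeriv_lineForm_partB k p.rep]
    have h := congrArg (fun g : Fin 6 → ℂ => ∑ j, g j * d j) hc
    simp only [Fin.sum_univ_three, Pi.add_apply, Pi.smul_apply, smul_eq_mul, Pi.zero_apply,
      zero_mul, Finset.sum_const_zero, add_mul, Finset.sum_add_distrib, mul_assoc,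
      ← Finset.mul_sum] at h
    exact h
  have hrep := p.rep_nonzero
  have hj := joinParts_partA_partB p.rep
  rw [lineParam_of_lineForm_eq_zero k _ hA, lineParam_of_lineForm_eq_zero k _ hB] at hj
  generalize p.rep = v at *
  generalize partA v (lineFst k) = u at hj
  generalize partA v (lineSnd k) = w at hj
  generalize partB v (lineFst k) = u' at hj
  generalize partB v (lineSnd k) = w' at hj
  subst hj
  -- Directions inside the join annihilate both linear forms and leave `c 2` times the differential
  -- of the cubic surface.
  have hdir : ∀ x y x' y', c 2 * ((3 * u ^ 2 - w ^ 2) * x - 2 * u * w * y +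
      ((3 * u' ^ 2 - w' ^ 2) * x' - 2 * u' * w' * y')) = 0 := by
    intro x y x' y'
    have := hpair (joinParts (lineParam k x y) (lineParam k x' y'))
    rwa [partA_joinParts, partB_joinParts, lineForm_lineParam, lineForm_lineParam, mul_zero,
      mul_zero, add_zero, zero_add, dirDeriv_otherEq] at this
  have hc2 : c 2 = 0 := by
    by_contra hc2
    obtain ⟨rfl, rfl⟩ := eq_zero_of_partials (u := u) (w := w) hc2
      (by linear_combination hdir 1 0 0 0) (by linear_combination -hdir 0 1 0 0)
    obtain ⟨rfl, rfl⟩ := eq_zero_of_partials (u := u') (w := w') hc2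
      (by linear_combination hdir 0 0 1 0) (by linear_combination -hdir 0 0 0 1)
    exact hrep (by rw [lineParam_zero, joinParts_zero])
  obtain ⟨e, he⟩ := exists_lineForm_eq_one k
  have hc0 := hpair (joinParts e 0)
  have hc1 := hpair (joinParts 0 e)
  rw [partA_joinParts, partB_joinParts, he, lineForm_zero, hc2] at hc0 hc1
  intro i
  fin_cases i
  · change c 0 = 0
    linear_combination hc0
  · change c 1 = 0
    linear_combination hc1
  · exact hc2

theorem isSmoothSurface_surface (k : Fin 6) : IsSmoothSurface (zeroSet (surfaceIdeal k)) := by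
  have hI : idealOf (zeroSet (surfaceIdeal k)) = surfaceIdeal k :=
    idealOf_zeroSet_span (isHomogeneous_surfaceGen k)
      ⟨_, singularPoint_mem_surface (k, true, true, 0)⟩ (isPrime_surfaceIdeal k)
  refine ⟨?_, ?_, ?_, ?_⟩
  · rw [zariskiClosure, hI]
  · rw [hI]
    exact isPrime_surfaceIdeal k
  · rw [hI]
    exact ringKrullDim_quotient_surfaceIdeal k
  · intro p hp
    rw [hI]
    exact isSmoothPoint_surface k hp

theorem exists_isSmoothSurface {p : ProjSpace 5} (hp : p ∈ singularLocus idealY' 2) :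
    ∃ S : Set (ProjSpace 5), IsSmoothSurface S ∧ S ⊆ Y' ∧ p ∈ S := by
  obtain ⟨i, rfl⟩ := exists_singularPoint_eq hp
  exact ⟨_, isSmoothSurface_surface i.1, surface_subset i.1, singularPoint_mem_surface i⟩

end Surfaces

/-! ### The complete intersection -/

section CompleteIntersection

open TrivSqZeroExt

theorem irreducible_X_add_X {K : Type*} [Field K] {n : ℕ} (j : Fin n) :
    Irreducible (X 0 + X j.succ : MvPolynomial (Fin (n + 1)) K) := by
  rw [← MulEquiv.irreducible_iff (finSuccEquiv K n), map_add, finSuccEquiv_X_zero,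
    finSuccEquiv_X_succ, ← sub_neg_eq_add, ← Polynomial.C_neg]
  exact Polynomial.irreducible_X_sub_C _

/-- Eisenstein's criterion for quadratic polynomials without linear term. -/
theorem irreducible_C_mul_X_sq_add {A : Type*} [CommRing A] [IsDomain A] {P : Ideal A}
    (hP : P.IsPrime) {a b : A} (ha : Irreducible a) (hab : ¬ a ∣ b) (haP : a ∉ P) (hb : b ∈ P)
    (hb2 : b ∉ P ^ 2) :
    Irreducible (Polynomial.C a * Polynomial.X ^ 2 + Polynomial.C b) := by
  have hdeg : (Polynomial.C b).degree < (Polynomial.C a * Polynomial.X ^ 2).degree := by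
    rw [Polynomial.degree_C_mul_X_pow _ ha.ne_zero]
    exact lt_of_le_of_lt Polynomial.degree_C_le (by norm_num)
  have hd : (Polynomial.C a * Polynomial.X ^ 2 + Polynomial.C b).degree = ((2 : ℕ) : WithBot ℕ) := by
    rw [Polynomial.degree_add_eq_left_of_degree_lt hdeg,
      Polynomial.degree_C_mul_X_pow _ ha.ne_zero]
  have hlc : (Polynomial.C a * Polynomial.X ^ 2 + Polynomial.C b).leadingCoeff = a := by
    rw [Polynomial.leadingCoeff, Polynomial.natDegree_eq_of_degree_eq_some hd]
    simp
  have hc0 : (Polynomial.C a * Polynomial.X ^ 2 + Polynomial.C b).coeff 0 = b := by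
    simp
  refine Polynomial.irreducible_of_eisenstein_criterion hP ?_ ?_ ?_ ?_ ?_
  · rwa [hlc]
  · intro n hn
    rw [hd] at hn
    have hn' : n < 2 := by exact_mod_cast hn
    interval_cases n
    · rwa [hc0]
    · simp [Polynomial.coeff_X_pow]
  · rw [hd]; norm_num
  · rwa [hc0]
  · intro r hr
    rw [Polynomial.C_dvd_iff_dvd_coeff] at hr
    have hra : r ∣ a := by
      have := hr 2
      simpa [Polynomial.coeff_C] using this
    have hrb : r ∣ b := by
      have := hr 0
      rwa [hc0] at this
    rcases ha.dvd_iff.mp hra with h | h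
    · exact h
    · exact absurd (h.dvd.trans hrb) hab

theorem irreducible_A1' : Irreducible A1' := by
  -- A'₁ is quadratic in v₃ without linear term. The swap makes v₃ the distinguished variable of
  -- `finSuccEquiv`.
  rw [← MulEquiv.irreducible_iff ((renameEquiv ℂ (Equiv.swap (0 : Fin 6) 3)).trans
    (finSuccEquiv ℂ 5))]
  have hS : (renameEquiv ℂ (Equiv.swap (0 : Fin 6) 3)).trans (finSuccEquiv ℂ 5) A1' =
      Polynomial.C (X 0 + X 1) * Polynomial.X ^ 2 +
        Polynomial.C (-(X 0 * X 1 * (X 0 + X 1)) + (X 2 + X 4) * (X 3 ^ 2 - X 2 * X 4)) := by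
    have e : ∀ j, renameEquiv ℂ (Equiv.swap (0 : Fin 6) 3) (X j) = X (Equiv.swap (0 : Fin 6) 3 j) :=
      fun j => rename_X ..
    have s0 : Equiv.swap (0 : Fin 6) 3 0 = (2 : Fin 5).succ := by decide
    have s1 : Equiv.swap (0 : Fin 6) 3 1 = (0 : Fin 5).succ := by decide
    have s2 : Equiv.swap (0 : Fin 6) 3 2 = (1 : Fin 5).succ := by decide
    have s3 : Equiv.swap (0 : Fin 6) 3 3 = 0 := by decide
    have s4 : Equiv.swap (0 : Fin 6) 3 4 = (3 : Fin 5).succ := by decide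
    have s5 : Equiv.swap (0 : Fin 6) 3 5 = (4 : Fin 5).succ := by decide
    rw [A1', F1, F2, F6, F7, AlgEquiv.trans_apply]
    simp only [map_add, map_sub, map_mul, map_pow, e, s0, s1, s2, s3, s4, s5, finSuccEquiv_X_zero,
      finSuccEquiv_X_succ, map_neg]
    ring
  rw [hS]
  -- Eisenstein at the prime of the subspace v₁ = 0, v₅ = -v₀. The constant term takes the value -ε
  -- at v₁ = ε, v₂ = 1 with the other variables zero, so it has order one there.
  refine irreducible_C_mul_X_sq_add (RingHom.ker_isPrime (aeval ![0, X 0, X 1, X 2, -X 1] :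
    MvPolynomial (Fin 5) ℂ →ₐ[ℂ] MvPolynomial (Fin 3) ℂ).toRingHom)
    (irreducible_X_add_X (0 : Fin 4)) ?_ ?_ ?_ ?_
  · rintro ⟨g, hg⟩
    -- At v₀ = v₄ = 1, v₁ = v₂ = v₅ = 0 the leading coefficient vanishes and the constant term is 1.
    have := congrArg (eval ![0, 0, 1, 1, 0]) hg
    simp at this
  · rw [RingHom.mem_ker]
    simp
  · rw [RingHom.mem_ker]
    simp
  · refine notMem_ker_sq_of_dualNumber _
      (aeval ![inr 1, 1, 0, 0, 0] : MvPolynomial (Fin 5) ℂ →ₐ[ℂ] DualNumber ℂ).toRingHom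
      (eval ![1, 0, 0]) (fun a => ?_) ?_
    · refine RingHom.congr_fun (f := (fstHom ℂ ℂ ℂ).toRingHom.comp _)
        (g := (eval ![1, 0, 0]).comp _) ?_ a
      refine MvPolynomial.ringHom_ext (fun c => ?_) (fun i => ?_)
      · simp
      · fin_cases i <;> simp
    · intro h
      have := congrArg snd h
      simp [pow_succ] at this

theorem not_A1'_dvd_A2' : ¬ A1' ∣ A2' := by
  rintro ⟨g, hg⟩
  -- At this point A'₁ = 0 and A'₂ = -1.
  have := congrArg (eval ![0, 1, -1, 0, 0, 0]) hg
  rw [map_mul, eval_A1', eval_A2'] at this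
  simp [pencilF, pencilG, partA, partB] at this

/-- A'₁ is prime and A'₂ is nonzero in the domain modulo A'₁. The quotient by both is nonzero
because they vanish at the origin. -/
theorem isRegular_A1'_A2' : RingTheory.Sequence.IsRegular (CoordRing 5) [A1', A2'] := by
  have hp : Prime A1' := irreducible_A1'.prime
  refine ⟨?_, ?_⟩
  · rw [RingTheory.Sequence.isWeaklyRegular_cons_iff, RingTheory.Sequence.isWeaklyRegular_singleton_iff]
    refine ⟨?_, ?_⟩
    · intro x y hxy
      exact mul_left_cancel₀ hp.ne_zero hxy
    · rw [isSMulRegular_quotient_iff_mem_of_smul_mem]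
      intro x hx
      rw [Submodule.mem_smul_pointwise_iff_exists] at hx ⊢
      obtain ⟨y, -, hy⟩ := hx
      rw [smul_eq_mul, smul_eq_mul] at hy
      obtain ⟨z, hz⟩ := (hp.dvd_or_dvd ⟨y, hy.symm⟩).resolve_left not_A1'_dvd_A2'
      exact ⟨z, Submodule.mem_top, hz.symm⟩
  · intro h
    have h1 : (1 : CoordRing 5) ∈ Ideal.ofList [A1', A2'] • (⊤ : Submodule (CoordRing 5) _) :=
      h ▸ Submodule.mem_top
    rw [smul_eq_mul, Ideal.mul_top] at h1
    have h2 : Ideal.ofList [A1', A2'] ≤ RingHom.ker (eval (0 : Fin 6 → ℂ)) := by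
      rw [Ideal.ofList, Ideal.span_le]
      intro F hF
      simp only [List.mem_cons, List.not_mem_nil, or_false] at hF
      rcases hF with rfl | rfl
      · rw [SetLike.mem_coe, RingHom.mem_ker, eval_A1']
        simp [pencilF, partA, partB]
      · rw [SetLike.mem_coe, RingHom.mem_ker, eval_A2']
        simp [pencilG, partA, partB]
    have := h2 h1
    simp at this

end CompleteIntersection

/-! ### The del Pezzo surface -/

section DelPezzo

theorem delPezzoD6Tilde_subset : delPezzoD6Tilde ⊆ Y' := by
  rintro p ⟨u, hu, hu', hmem, rfl⟩
  have key : ∀ F : CoordRing 5, (∀ (c : ℂ) (x : Fin 3 → ℂ),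
      eval (fun j : Fin 6 => (c • cubicForms x) j.castSucc) F = 0) →
      eval (fun j : Fin 6 => u j.castSucc) F = 0 := by
    intro F hF
    -- The projection forgets the last coordinate: `F`, read as a polynomial in seven variables,
    -- vanishes on the parametrized cone, hence on its closure.
    have h := hmem (rename (Fin.castSucc : Fin 6 → Fin 7) F) ?_ u ?_
    · rw [eval_rename] at h
      exact h
    · rintro v ⟨q, ⟨x, hx, rfl⟩, hv⟩
      rw [Projectivization.submodule_mk, Submodule.mem_span_singleton] at hv
      obtain ⟨c, rfl⟩ := hv
      rw [aeval_rename]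
      exact hF c x
    · rw [Projectivization.submodule_mk]
      exact Submodule.mem_span_singleton_self u
  rw [mk_mem_Y'_iff]
  refine ⟨key _ fun c x => ?_, key _ fun c x => ?_⟩
  · rw [eval_A1']
    simp [pencilF, partA, partB, cubicForms]
    ring
  · rw [eval_A2']
    simp [pencilG, partA, partB, cubicForms]
    ring

end DelPezzo

/-! ### An automorphism of order six -/

section Automorphism

/-- The cyclic permutation `(0 2 4 1 5 3)` of the coordinates. -/
def coordCycle : Equiv.Perm (Fin 6) where
  toFun := ![2, 5, 4, 0, 1, 3]
  invFun := ![3, 4, 0, 5, 2, 1]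
  left_inv := by decide
  right_inv := by decide

theorem coordCycle_pow_six : coordCycle ^ 6 = 1 := by decide

theorem coordCycle_pow_apply_zero_ne {m : ℕ} (hm : 0 < m) (hm' : m < 6) :
    (coordCycle ^ m) 0 ≠ 0 := by
  interval_cases m <;> decide

/-- With σ(x, y, z) = (y, z, x) the permutation maps the parts (a, b) to (σb, σa), and F ∘ σ = G -
F, G ∘ σ = -F. -/
theorem pencil_comp_coordCycle (v : Fin 6 → ℂ) :
    eval (v ∘ coordCycle) A1' = eval v A2' - eval v A1' ∧
      eval (v ∘ coordCycle) A2' = -eval v A1' := by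
  rw [eval_A1', eval_A2', eval_A1', eval_A2']
  simp only [pencilF, pencilG, partA, partB, coordCycle, Equiv.coe_fn_mk, Function.comp_apply,
    Matrix.cons_val]
  constructor <;> ring

/-- The action of permutations of the coordinates on projective space. -/
noncomputable def permuteCoords (τ : Equiv.Perm (Fin 6)) : Equiv.Perm (ProjSpace 5) :=
  MulAction.toPermHom _ _ (DomMulAct.mk τ)

theorem permuteCoords_mk (τ : Equiv.Perm (Fin 6)) (v : Fin 6 → ℂ) (hv : v ≠ 0) (h : v ∘ τ ≠ 0) :
    permuteCoords τ (Projectivization.mk ℂ v hv) = Projectivization.mk ℂ (v ∘ τ) h := rfl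

theorem comp_perm_ne_zero (τ : Equiv.Perm (Fin 6)) {v : Fin 6 → ℂ} (hv : v ≠ 0) : v ∘ τ ≠ 0 := by
  intro h
  refine hv (funext fun j => ?_)
  simpa using congrFun h (τ.symm j)

theorem permuteCoords_pow (τ : Equiv.Perm (Fin 6)) (m : ℕ) :
    permuteCoords τ ^ m = permuteCoords (τ ^ m) := by
  rw [permuteCoords, ← map_pow]
  congr 1

theorem permuteCoords_inv (τ : Equiv.Perm (Fin 6)) :
    (permuteCoords τ)⁻¹ = permuteCoords τ⁻¹ := by
  rw [permuteCoords, ← map_inv]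
  congr 1

theorem permuteCoords_mem_Y'_iff (p : ProjSpace 5) : permuteCoords coordCycle p ∈ Y' ↔ p ∈ Y' := by
  induction p using Projectivization.ind with
  | h v hv =>
    rw [permuteCoords_mk coordCycle v hv (comp_perm_ne_zero _ hv), mk_mem_Y'_iff, mk_mem_Y'_iff,
      (pencil_comp_coordCycle v).1, (pencil_comp_coordCycle v).2, neg_eq_zero, sub_eq_zero]
    constructor
    · rintro ⟨h1, h2⟩
      exact ⟨h2, h1.trans h2⟩
    · rintro ⟨h1, h2⟩
      exact ⟨h2.trans h1.symm, h1⟩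

theorem isRegularMap_of_permuteCoords {Y : Set (ProjSpace 5)} (τ : Equiv.Perm (Fin 6)) (f : Y → Y)
    (hf : ∀ q : Y, (f q : ProjSpace 5) = permuteCoords τ q) : IsRegularMap Y f := by
  intro p
  have key : ∀ v : Fin 6 → ℂ, evalTuple (fun j => (X (τ j) : CoordRing 5)) v = v ∘ τ := by
    intro v; funext j; simp [evalTuple]
  refine ⟨1, fun j => X (τ j), fun j => isHomogeneous_X _ _, ?_, ?_⟩
  · rw [key]
    exact comp_perm_ne_zero τ p.1.rep_nonzero
  · intro q h
    have h1 := permuteCoords_mk τ _ q.1.rep_nonzero (comp_perm_ne_zero τ q.1.rep_nonzero)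
    rw [Projectivization.mk_rep] at h1
    rw [hf, h1]
    simp only [key]

/-- The automorphism of `Y'` given by the cyclic permutation of the coordinates. -/
noncomputable def cycleAut : Equiv.Perm Y' :=
  (permuteCoords coordCycle).subtypePerm permuteCoords_mem_Y'_iff

theorem cycleAut_mem : cycleAut ∈ autGroup Y' := by
  refine ⟨isRegularMap_of_permuteCoords coordCycle _ fun q => rfl,
    isRegularMap_of_permuteCoords coordCycle⁻¹ _ fun q => ?_⟩
  rw [← permuteCoords_inv, Equiv.Perm.eq_inv_iff_eq]
  exact congrArg Subtype.val (cycleAut.apply_symm_apply q)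

theorem orderOf_cycleAut : orderOf cycleAut = 6 := by
  rw [orderOf_eq_iff (by norm_num)]
  have hpow : ∀ m (q : Y'), ((cycleAut ^ m) q : ProjSpace 5) = permuteCoords (coordCycle ^ m) q := by
    intro m q
    rw [cycleAut, Equiv.Perm.subtypePerm_pow, ← permuteCoords_pow]
    rfl
  refine ⟨?_, fun m hm hm' h => ?_⟩
  · ext q
    rw [hpow, coordCycle_pow_six]
    simp [permuteCoords]
  -- The coordinate point e₀ lies on Y', and no smaller power fixes it because the permutation is a
  -- 6-cycle.
  · have hv : (Pi.single 0 1 : Fin 6 → ℂ) ≠ 0 := by simp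
    have hmem : Projectivization.mk ℂ (Pi.single 0 1 : Fin 6 → ℂ) hv ∈ Y' := by
      rw [mk_mem_Y'_iff, eval_A1', eval_A2']
      simp [pencilF, pencilG, partA, partB]
    have h1 := hpow m ⟨_, hmem⟩
    rw [h, permuteCoords_mk _ _ _ (comp_perm_ne_zero _ hv), Equiv.Perm.one_apply,
      Projectivization.mk_eq_mk_iff'] at h1
    obtain ⟨a, ha⟩ := h1
    have := congrFun ha 0
    simp [coordCycle_pow_apply_zero_ne hm' hm] at this

theorem exists_isCyclic_subgroup :
    ∃ H : Subgroup (autGroup Y'), IsCyclic H ∧ Nat.card H = 6 := by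
  refine ⟨Subgroup.zpowers ⟨cycleAut, cycleAut_mem⟩, inferInstance, ?_⟩
  rw [Nat.card_zpowers, Subgroup.orderOf_mk, orderOf_cycleAut]

end Automorphism

theorem lemma4p1 :
    -- `Y'` is a complete intersection
    RingTheory.Sequence.IsRegular (CoordRing 5) [A1', A2'] ∧
    delPezzoD6Tilde ⊆ Y' ∧
    -- the singular points of `Y'` are 72 ordinary double points
    (ProjVar.singularLocus idealY' 2).ncard = 72 ∧
    (∀ p ∈ ProjVar.singularLocus idealY' 2, ProjVar.IsOrdinaryDoublePoint idealY' 2 p) ∧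
    -- through each of them passes a smooth surface in `Y'`
    (∀ p ∈ ProjVar.singularLocus idealY' 2,
      ∃ S : Set (ProjSpace 5), ProjVar.IsSmoothSurface S ∧ S ⊆ Y' ∧ p ∈ S) ∧
    ∃ H : Subgroup (ProjVar.autGroup Y'), IsCyclic H ∧ Nat.card H = 6 :=
  ⟨isRegular_A1'_A2', delPezzoD6Tilde_subset, ncard_singularLocus,
    fun _ hp => isOrdinaryDoublePoint_of_mem_singularLocus hp,
    fun _ hp => exists_isSmoothSurface hp, exists_isCyclic_subgroup⟩
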